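/- Let $d\ge 1$ be an integer and $\sigma>0$. On $\mathbb Z^d$ let $\Delta_{disc}u_n=\sum_{|j-n|=1}u_j-2d\,u_n$. For $\omega>0$ and real-valued $u\in l^2(\mathbb Z^d)$ put $$J_\omega[u]=\sum_{\{j,n\}:\,|j-n|=1}|u_j-u_n|^2+\omega\sum_{n}|u_n|^2,$$ where each unordered pair of nearest neighbours is counted once, and $j(\omega)=\inf\{J_\omega[u]:\ \sum_n|u_n|^{2\sigma+2}=1\}$. A homogeneous wave at frequency $\omega$ is a sequence $\varphi=j(\omega)^{1/(2\sigma)}u$, where $u$ attains this infimum. For such a wave let $$\mathcal L_+=-\Delta_{disc}+\omega-(2\sigma+1)|\varphi|^{2\sigma},\qquad \mathcal L_-=-\Delta_{disc}+\omega-|\varphi|^{2\sigma}.$$ The wave $\varphi$ is called non-degenerate if $\mathcal L_+$ has trivial kernel in $l^2(\mathbb Z^d)$. The standing wave $e^{i\omega t}\varphi$ of the equation $i\partial_tu_n+\Delta_{disc}u_n+|u_n|^{2\sigma}u_n=0$ is called spectrally stable if there do not exist $\lambda\in\mathbb C$ with $\Re\lambda>0$ and $(v,w)\ne(0,0)$ in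 $l^2(\mathbb Z^d;\mathbb C)^2$ such that $$\begin{pmatrix}0&-1\\1&0\end{pmatrix}\begin{pmatrix}\mathcal L_+&0\\0&\mathcal L_-\end{pmatrix}\begin{pmatrix}v\\w\end{pmatrix}=\lambda\begin{pmatrix}v\\w\end{pmatrix}.$$ Let $(a,b)\subset(0,\infty)$, and for every $\omega\in(a,b)$ let $\varphi_\omega$ be a homogeneous wave at frequency $\omega$. Suppose that the map $\omega\mapsto\varphi_\omega\in l^2(\mathbb Z^d)$ is continuous on $(a,b)$ and that $\varphi_\omega$ is non-degenerate for every $\omega\in(a,b)$. Then $\omega\mapsto\|\varphi_\omega\|_{l^2}$ is differentiable on $(a,b)$, and for every $\omega\in(a,b)$ the wave $e^{i\omega t}\varphi_\omega$ is spectrally stable if and only if $\partial_\omega\|\varphi_\omega\|_{l^2}^2\ge0$. -/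

import Mathlib

noncomputable section

namespace DNLS

/-- The space `ℓ²(ℤ^d; E)`, with its usual norm. -/
abbrev EllTwo (d : ℕ) (E : Type) [NormedAddCommGroup E] : Type :=
  lp (fun _ : Fin d → ℤ => E) 2

/-- The `i`-th coordinate vector of `ℤ^d`. The nearest neighbours of a site `n` (the sites at
distance one from it) are `n + e i` and `n - e i`, for `i : Fin d`. -/
def e {d : ℕ} (i : Fin d) : Fin d → ℤ := Pi.single i 1

/-- The discrete Laplacian: the sum of the values at the `2d` nearest neighbours, minus `2d` times
the value at the site. The values lie in `ℝ` or in `ℂ`. -/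
def discLaplacian {d : ℕ} {E : Type} [AddCommGroup E] [Module ℝ E]
    (f : (Fin d → ℤ) → E) (n : Fin d → ℤ) : E :=
  (∑ i : Fin d, (f (n + e i) + f (n - e i))) - (2 * (d : ℝ)) • f n

/-- The functional `J[u] = ∑ |u_j - u_n|² + ω ∑ |u_n|²`, where the first sum is over the
nearest-neighbour bonds of the lattice, each counted once, so that it equals `⟨-Δ u, u⟩`. -/
def J {d : ℕ} (ω : ℝ) (u : EllTwo d ℝ) : ℝ :=
  (∑' n : Fin d → ℤ, ∑ i : Fin d, |u (n + e i) - u n| ^ 2) + ω * ∑' n : Fin d → ℤ, |u n| ^ 2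

/-- The constraint set `∑ |u_n|^(2σ+2) = 1`. -/
def constraintSet (d : ℕ) (σ : ℝ) : Set (EllTwo d ℝ) :=
  {u | ∑' n : Fin d → ℤ, |u n| ^ (2 * σ + 2) = 1}

/-- The minimal value `j(ω) = inf J` over the constraint set. -/
def jmin (d : ℕ) (σ ω : ℝ) : ℝ := sInf (J ω '' constraintSet d σ)

/-- `u` solves the constrained minimization problem. -/
def IsConstrainedMinimizer {d : ℕ} (σ ω : ℝ) (u : EllTwo d ℝ) : Prop :=
  u ∈ constraintSet d σ ∧ ∀ v ∈ constraintSet d σ, J ω u ≤ J ω v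

/-- `φ` is a homogeneous wave with frequency `ω`: a rescaling, by `j(ω)^(1/(2σ))`, of a
constrained minimizer. -/
def IsHomogeneousWave {d : ℕ} (σ ω : ℝ) (φ : EllTwo d ℝ) : Prop :=
  ∃ u : EllTwo d ℝ, IsConstrainedMinimizer σ ω u ∧ φ = (jmin d σ ω) ^ (1 / (2 * σ)) • u

/-- `L₊ = -Δ + ω - (2σ+1) |φ|^(2σ)`. -/
def Lplus {d : ℕ} {E : Type} [AddCommGroup E] [Module ℝ E] (σ ω : ℝ) (φ : EllTwo d ℝ)
    (f : (Fin d → ℤ) → E) (n : Fin d → ℤ) : E :=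
  -discLaplacian f n + ω • f n - ((2 * σ + 1) * |φ n| ^ (2 * σ)) • f n

/-- `L₋ = -Δ + ω - |φ|^(2σ)`. -/
def Lminus {d : ℕ} {E : Type} [AddCommGroup E] [Module ℝ E] (σ ω : ℝ) (φ : EllTwo d ℝ)
    (f : (Fin d → ℤ) → E) (n : Fin d → ℤ) : E :=
  -discLaplacian f n + ω • f n - (|φ n| ^ (2 * σ)) • f n

/-- The wave is non-degenerate: `L₊` has trivial kernel in `ℓ²`. -/
def IsNondegenerate {d : ℕ} (σ ω : ℝ) (φ : EllTwo d ℝ) : Prop :=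
  ∀ f : EllTwo d ℝ, (∀ n, Lplus σ ω φ (⇑f) n = 0) → f = 0

/-- The standing wave `exp(iωt) φ` is spectrally stable: the linearized eigenvalue problem
`[[0, -1], [1, 0]] [[L₊, 0], [0, L₋]] (v, w) = μ (v, w)` has no nonzero solution
`(v, w) ∈ ℓ² × ℓ²` with `Re μ > 0`. -/
def IsSpectrallyStable {d : ℕ} (σ ω : ℝ) (φ : EllTwo d ℝ) : Prop :=
  ¬ ∃ (μ : ℂ) (v w : EllTwo d ℂ), 0 < μ.re ∧ (v, w) ≠ 0 ∧
    (∀ n, -Lminus σ ω φ (⇑w) n = μ * v n) ∧ (∀ n, Lplus σ ω φ (⇑v) n = μ * w n)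

end DNLS

end

/-! By homogeneity, minimality becomes ∑|v|^(2σ+2) ≤ J[φ] (J[v]/J[φ])^(σ+1) for all v, with equality
at φ (`IsOptimizer`). Its first variation gives L₋φ = 0. Its second gives L₊ ≥ 0 on the complement
of L₊φ = -2σ|φ|^(2σ)φ, while ⟪L₊φ, φ⟫ < 0. With Young's inequality it gives L₋ ≥ 0, and
connectedness of the lattice makes φ span ker L₋.

Both L± are coercive minus compact, since |φ|^(2σ) decays at infinity. Non-degeneracy therefore
makes L₊ invertible; put ψ = L₊⁻¹φ. If ⟪φ, ψ⟫ ≤ 0, then L₊ ≥ 0 on φ^⊥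
(`inner_nonneg_of_orthogonal`), and a sign argument excludes Re λ > 0 (`eq_zero_of_growing_mode`).
If ⟪φ, ψ⟫ > 0, L₊ has a negative direction in φ^⊥. Then L₊x = -m L₋⁻¹x, solved in φ^⊥ modulo φ, has
a solution with m > 0, and √m is an unstable eigenvalue (`exists_growing_mode`).

Invertibility also makes the continuous branch differentiable (`hasDerivAt_branch`), with L₊ ∂φ =
-φ. Hence ∂‖φ‖² = -2⟪φ, ψ⟫, and the two sign conditions coincide. -/

namespace DNLS

open scoped InnerProductSpace

/-! ### Coercive-minus-compact operators and positive symmetric operators -/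

section Abstract

variable {H : Type*} [NormedAddCommGroup H] [InnerProductSpace ℝ H]

/-- The Fredholm alternative for a compact perturbation of a coercive operator. -/
theorem exists_equiv_of_coercive_sub_compact [CompleteSpace H] (C K : H →L[ℝ] H) {c : ℝ} (hc : 0 < c)
    (hC : ∀ x, c * ‖x‖ ^ 2 ≤ ⟪C x, x⟫_ℝ) (hK : IsCompactOperator K)
    (hinj : ∀ x, C x - K x = 0 → x = 0) :
    ∃ e : H ≃L[ℝ] H, ∀ x, e x = C x - K x := by
  have hco : IsCoercive ((innerSL ℝ).comp C) := by
    refine ⟨c, hc, fun u => ?_⟩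
    have := hC u
    simp only [ContinuousLinearMap.comp_apply, innerSL_apply_apply]
    nlinarith
  set E := hco.continuousLinearEquivOfBilin with hE
  have hEC : ∀ x, E x = C x := fun x => by
    refine ext_inner_right ℝ fun w => ?_
    rw [hE, IsCoercive.continuousLinearEquivOfBilin_apply]
    simp
  -- C - K = E(1 - T) with T compact, so injectivity only has to exclude the eigenvalue 1 of T.
  set T : H →L[ℝ] H := (E.symm : H →L[ℝ] H).comp K with hT
  have hTK : IsCompactOperator T := hK.clm_comp (E.symm : H →L[ℝ] H)
  have hne : ¬ Module.End.HasEigenvalue (T : Module.End ℝ H) 1 := by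
    intro h
    obtain ⟨v, hv⟩ := h.exists_hasEigenvector
    have h1 : E.symm (K v) = v := by simpa [hT] using hv.apply_eq_smul
    refine hv.2 (hinj v ?_)
    rw [← hEC, ← h1, E.apply_symm_apply, h1, sub_self]
  have hres : (1 : ℝ) ∈ resolventSet ℝ T :=
    (hTK.hasEigenvalue_or_mem_resolventSet one_ne_zero).resolve_left hne
  rw [spectrum.mem_resolventSet_iff, map_one] at hres
  obtain ⟨U, hU⟩ := hres
  refine ⟨(ContinuousLinearEquiv.unitsEquiv ℝ H U).trans E, fun x => ?_⟩
  have : (U : H →L[ℝ] H) x = x - T x := by rw [hU]; simp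
  simp only [ContinuousLinearEquiv.trans_apply, ContinuousLinearEquiv.unitsEquiv_apply, this,
    map_sub, hEC x]
  simp [hT]

/-- A bounded equivalence is bounded below. -/
theorem exists_pos_le_norm (e : H ≃L[ℝ] H) : ∃ c > 0, ∀ x, c * ‖x‖ ≤ ‖e x‖ := by
  refine ⟨(‖(e.symm : H →L[ℝ] H)‖ + 1)⁻¹, by positivity, fun x => ?_⟩
  rw [inv_mul_le_iff₀ (by positivity)]
  have := (e.symm : H →L[ℝ] H).le_opNorm (e x)
  simp only [ContinuousLinearEquiv.coe_coe, ContinuousLinearEquiv.symm_apply_apply] at this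
  nlinarith [norm_nonneg (e x)]

/-- For a positive symmetric operator, `‖T x‖² ≤ (‖T‖ + 1) ⟪T x, x⟫`. -/
theorem norm_sq_le_of_nonneg (T : H →L[ℝ] H) (hsymm : ∀ x y, ⟪T x, y⟫_ℝ = ⟪x, T y⟫_ℝ)
    (hpos : ∀ x, 0 ≤ ⟪T x, x⟫_ℝ) (x : H) : ‖T x‖ ^ 2 ≤ (‖T‖ + 1) * ⟪T x, x⟫_ℝ := by
  set M := ‖T‖ + 1 with hM
  have hM0 : 0 < M := by positivity
  -- The form at Mx - Tx is M²⟪Tx, x⟫ - 2M‖Tx‖² + ⟪TTx, Tx⟫, and the last term is at most M‖Tx‖².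
  have h := hpos (M • x - T x)
  have h1 : ⟪T (T x), T x⟫_ℝ ≤ M * ‖T x‖ ^ 2 := by
    calc ⟪T (T x), T x⟫_ℝ ≤ ‖T (T x)‖ * ‖T x‖ := real_inner_le_norm _ _
      _ ≤ (‖T‖ * ‖T x‖) * ‖T x‖ := by gcongr; exact T.le_opNorm _
      _ ≤ M * ‖T x‖ ^ 2 := by nlinarith [sq_nonneg (‖T x‖)]
  have h2 : ⟪T (T x), x⟫_ℝ = ‖T x‖ ^ 2 := by rw [hsymm, real_inner_self_eq_norm_sq]
  have h3 : ⟪T x, T x⟫_ℝ = ‖T x‖ ^ 2 := real_inner_self_eq_norm_sq _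
  simp only [map_sub, map_smul, inner_sub_left, inner_sub_right, inner_smul_left,
    inner_smul_right, h2, h3, RCLike.conj_to_real] at h
  have h4 : 0 ≤ M * (M * ⟪T x, x⟫_ℝ - ‖T x‖ ^ 2) := by nlinarith
  have := nonneg_of_mul_nonneg_right h4 hM0
  linarith

theorem eq_zero_of_inner_self_eq_zero (T : H →L[ℝ] H) (hsymm : ∀ x y, ⟪T x, y⟫_ℝ = ⟪x, T y⟫_ℝ)
    (hpos : ∀ x, 0 ≤ ⟪T x, x⟫_ℝ) {x : H} (hx : ⟪T x, x⟫_ℝ = 0) : T x = 0 := by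
  have := norm_sq_le_of_nonneg T hsymm hpos x
  rw [hx, mul_zero] at this
  exact norm_eq_zero.1 (pow_eq_zero_iff two_ne_zero |>.1 (le_antisymm this (sq_nonneg _)))

/-- A positive symmetric boundedly invertible operator is coercive. -/
theorem exists_coercive_of_equiv (e : H ≃L[ℝ] H) (hsymm : ∀ x y, ⟪e x, y⟫_ℝ = ⟪x, e y⟫_ℝ)
    (hpos : ∀ x, 0 ≤ ⟪e x, x⟫_ℝ) : ∃ c > 0, ∀ x, c * ‖x‖ ^ 2 ≤ ⟪e x, x⟫_ℝ := by
  obtain ⟨c, hc, h⟩ := exists_pos_le_norm e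
  refine ⟨c ^ 2 / (‖(e : H →L[ℝ] H)‖ + 1), by positivity, fun x => ?_⟩
  have h1 := norm_sq_le_of_nonneg (e : H →L[ℝ] H) hsymm hpos x
  rw [div_mul_eq_mul_div, div_le_iff₀ (by positivity), ← mul_pow]
  calc (c * ‖x‖) ^ 2 ≤ ‖e x‖ ^ 2 := by gcongr; exact h x
    _ ≤ _ := by rw [mul_comm]; exact h1

/-- The generalized eigenvalue problem `L x = -m S x` has a solution with `m > 0` if the quadratic
form of `L`, a compact perturbation of a coercive operator, takes a negative value. -/
theorem exists_generalized_eigenvector [CompleteSpace H] (C K S : H →L[ℝ] H) {c s : ℝ} (hc : 0 < c) (hs : 0 < s)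
    (hC : ∀ x, c * ‖x‖ ^ 2 ≤ ⟪C x, x⟫_ℝ) (hK : IsCompactOperator K)
    (hS : ∀ x, s * ‖x‖ ^ 2 ≤ ⟪S x, x⟫_ℝ)
    (hLsymm : ∀ x y, ⟪C x - K x, y⟫_ℝ = ⟪x, C y - K y⟫_ℝ)
    (hSsymm : ∀ x y, ⟪S x, y⟫_ℝ = ⟪x, S y⟫_ℝ)
    {x₀ : H} (hx₀ : ⟪C x₀ - K x₀, x₀⟫_ℝ < 0) :
    ∃ m : ℝ, 0 < m ∧ ∃ x : H, x ≠ 0 ∧ C x - K x + m • S x = 0 := by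
  set q : ℝ → H → ℝ := fun m x => ⟪C x - K x, x⟫_ℝ + m * ⟪S x, x⟫_ℝ with hq
  -- The eigenvalue is m = sup M. There L + mS is nonnegative; if it were injective it would be
  -- invertible, hence coercive, and the form would stay nonnegative slightly below m, against the
  -- choice of m.
  set M : Set ℝ := {m | ∃ x, q m x < 0} with hM
  have hbdd : BddAbove M := by
    -- Beyond this value m S dominates K.
    refine ⟨‖K‖ / s, ?_⟩
    rintro m ⟨x, hx⟩
    by_contra! hlt
    have h1 : ⟪K x, x⟫_ℝ ≤ ‖K‖ * ‖x‖ ^ 2 :=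
      (real_inner_le_norm _ _).trans (by
        rw [pow_two, ← mul_assoc]; gcongr; exact K.le_opNorm x)
    have hm : ‖K‖ < m * s := (div_lt_iff₀ hs).1 hlt
    have hm0 : 0 ≤ m := (div_nonneg (norm_nonneg _) hs.le).trans hlt.le
    have h2 := mul_le_mul_of_nonneg_left (hS x) hm0
    have h3 := hC x
    have h4 : 0 ≤ c * ‖x‖ ^ 2 := by positivity
    have h5 : ‖K‖ * ‖x‖ ^ 2 ≤ m * s * ‖x‖ ^ 2 := by gcongr
    simp only [hq, inner_sub_left] at hx
    nlinarith
  obtain ⟨m₁, hm₁, hm₁M⟩ : ∃ m₁ > 0, m₁ ∈ M := by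
    have hS0 : 0 ≤ ⟪S x₀, x₀⟫_ℝ := le_trans (by positivity) (hS x₀)
    refine ⟨-⟪C x₀ - K x₀, x₀⟫_ℝ / (⟪S x₀, x₀⟫_ℝ + 1) / 2, ?_, x₀, ?_⟩
    · have : 0 < -⟪C x₀ - K x₀, x₀⟫_ℝ := by linarith
      positivity
    · simp only [hq]
      set a := -⟪C x₀ - K x₀, x₀⟫_ℝ with ha
      have ha0 : 0 < a := by linarith
      have h1 : a / (⟪S x₀, x₀⟫_ℝ + 1) * ⟪S x₀, x₀⟫_ℝ ≤ a := by
        rw [div_mul_eq_mul_div, div_le_iff₀ (by positivity)]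
        nlinarith
      have : a / (⟪S x₀, x₀⟫_ℝ + 1) / 2 * ⟪S x₀, x₀⟫_ℝ ≤ a / 2 := by linarith
      linarith
  set m := sSup M with hm
  have hm0 : 0 < m := hm₁.trans_le (le_csSup hbdd hm₁M)
  set B : H →L[ℝ] H := C - K + m • S with hB
  have hBapp : ∀ x, B x = C x - K x + m • S x := fun x => by simp [hB]
  have hBq : ∀ x, ⟪B x, x⟫_ℝ = q m x := fun x => by
    simp [hBapp, hq, inner_add_left, inner_smul_left]
  have hBpos : ∀ x, 0 ≤ ⟪B x, x⟫_ℝ := by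
    intro x
    rw [hBq]
    by_contra! hlt
    have hcont : Continuous fun t : ℝ => q t x := by simp only [hq]; fun_prop
    have hev : ∀ᶠ t in nhdsWithin m (Set.Ioi m), q t x < 0 :=
      (hcont.tendsto m).mono_left nhdsWithin_le_nhds |>.eventually (gt_mem_nhds hlt)
    obtain ⟨t, ht, hmt⟩ := (hev.and self_mem_nhdsWithin).exists
    exact absurd (le_csSup hbdd (show t ∈ M from ⟨x, ht⟩)) (not_le.2 hmt)
  by_contra! hno
  have hinj : ∀ x, (C + m • S) x - K x = 0 → x = 0 := by
    intro x hx
    by_contra hx0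
    refine hno m hm0 x hx0 ?_
    rw [← hx]
    simp only [add_apply, smul_apply]
    abel
  have hCm : ∀ x, c * ‖x‖ ^ 2 ≤ ⟪(C + m • S) x, x⟫_ℝ := by
    intro x
    have h1 : 0 ≤ ⟪S x, x⟫_ℝ := le_trans (by positivity) (hS x)
    have h2 := hC x
    simp only [add_apply, smul_apply, inner_add_left,
      inner_smul_left, RCLike.conj_to_real]
    nlinarith [mul_nonneg hm0.le h1]
  obtain ⟨e, he⟩ := exists_equiv_of_coercive_sub_compact (C + m • S) K hc hCm hK hinj
  have heB : ∀ x, e x = B x := fun x => by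
    rw [he, hBapp]
    simp only [add_apply, smul_apply]
    abel
  obtain ⟨δ, hδ, hδe⟩ := exists_coercive_of_equiv e
    (fun x y => by
      rw [heB, heB, hBapp, hBapp, inner_add_left, inner_add_right, hLsymm, inner_smul_left,
        inner_smul_right, hSsymm]
      rfl)
    (fun x => by rw [heB]; exact hBpos x)
  obtain ⟨t, ⟨x, hx⟩, htm⟩ := exists_lt_of_lt_csSup ⟨m₁, hm₁M⟩
    (show m - δ / (‖S‖ + 1) < sSup M by
      have : 0 < δ / (‖S‖ + 1) := by positivity
      linarith)
  have h1 := hδe x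
  rw [heB, hBq] at h1
  simp only [hq] at h1 hx
  have h2 : ⟪S x, x⟫_ℝ ≤ (‖S‖ + 1) * ‖x‖ ^ 2 :=
    (real_inner_le_norm _ _).trans (by
      rw [pow_two, ← mul_assoc]; gcongr
      exact (S.le_opNorm x).trans (by gcongr; linarith))
  have h3 : 0 ≤ ⟪S x, x⟫_ℝ := le_trans (by positivity) (hS x)
  have h4 : δ / (‖S‖ + 1) * ⟪S x, x⟫_ℝ ≤ δ * ‖x‖ ^ 2 := by
    rw [div_mul_eq_mul_div, div_le_iff₀ (by positivity)]
    nlinarith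
  have h5 : (m - δ / (‖S‖ + 1)) * ⟪S x, x⟫_ℝ ≤ t * ⟪S x, x⟫_ℝ := by gcongr
  linarith

end Abstract

/-! ### The Vakhitov–Kolokolov argument in a Hilbert space -/

section VakhitovKolokolov

variable {H : Type*} [NormedAddCommGroup H] [InnerProductSpace ℝ H]

/-- The compression of an operator to a subspace. -/
noncomputable def compression (X : Submodule ℝ H) [X.HasOrthogonalProjection] (T : H →L[ℝ] H) :
    X →L[ℝ] X :=
  X.orthogonalProjectionOnto.comp (T.comp X.subtypeL)

theorem inner_compression_left (X : Submodule ℝ H) [X.HasOrthogonalProjection] (T : H →L[ℝ] H)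
    (x y : X) : ⟪compression X T x, y⟫_ℝ = ⟪T x, (y : H)⟫_ℝ :=
  X.inner_orthogonalProjectionOnto_eq_of_mem_right y (T x)

theorem inner_compression_right (X : Submodule ℝ H) [X.HasOrthogonalProjection] (T : H →L[ℝ] H)
    (x y : X) : ⟪x, compression X T y⟫_ℝ = ⟪(x : H), T y⟫_ℝ :=
  X.inner_orthogonalProjectionOnto_eq_of_mem_left x (T y)

theorem isCompactOperator_compression (X : Submodule ℝ H) [X.HasOrthogonalProjection]
    {T : H →L[ℝ] H} (hT : IsCompactOperator T) : IsCompactOperator (compression X T) :=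
  (hT.comp_clm X.subtypeL).clm_comp X.orthogonalProjectionOnto

/-- A positive operator with kernel spanned by `φ`, a compact perturbation of a coercive one,
has a symmetric coercive partial inverse on the orthogonal complement of `φ`. -/
theorem exists_inverse_on_orthogonal [CompleteSpace H] (C K : H →L[ℝ] H) {c : ℝ} (hc : 0 < c)
    (hC : ∀ x, c * ‖x‖ ^ 2 ≤ ⟪C x, x⟫_ℝ) (hK : IsCompactOperator K)
    (hsymm : ∀ x y, ⟪C x - K x, y⟫_ℝ = ⟪x, C y - K y⟫_ℝ)
    (hpos : ∀ x, 0 ≤ ⟪C x - K x, x⟫_ℝ) {φ : H} (hφ : φ ≠ 0) (hφK : C φ - K φ = 0)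
    (hker : ∀ x, C x - K x = 0 → ∃ r : ℝ, x = r • φ) :
    ∃ S : H →L[ℝ] H, (∀ x y, ⟪S x, y⟫_ℝ = ⟪x, S y⟫_ℝ) ∧
      (∃ s > 0, ∀ x, s * ‖x‖ ^ 2 ≤ ⟪S x, x⟫_ℝ) ∧
      ∀ x, ⟪φ, x⟫_ℝ = 0 → C (S x) - K (S x) = x := by
  -- Adding the rank-one form ⟪φ, ·⟫φ removes the kernel and preserves positivity. The inverse of
  -- the sum maps φ^⊥ into itself, where it inverts the original operator.
  set R : H →L[ℝ] H := (innerSL ℝ φ).smulRight φ with hR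
  have hRapp : ∀ x, R x = ⟪φ, x⟫_ℝ • φ := fun x => by simp [hR]
  have hRK : IsCompactOperator (K - R) := by
    refine hK.sub ?_
    have : IsCompactOperator (innerSL ℝ φ) := isCompactOperator_of_locallyCompactSpace_dom _
    exact this.clm_comp ((1 : ℝ →L[ℝ] ℝ).smulRight φ)
  have hTapp : ∀ x, C x - (K - R) x = (C x - K x) + ⟪φ, x⟫_ℝ • φ := fun x => by
    rw [sub_apply, hRapp]; abel
  have hTinner : ∀ x y, ⟪C x - (K - R) x, y⟫_ℝ = ⟪C x - K x, y⟫_ℝ + ⟪φ, x⟫_ℝ * ⟪φ, y⟫_ℝ := by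
    intro x y
    rw [hTapp, inner_add_left, inner_smul_left]; rfl
  have hTsymm : ∀ x y, ⟪C x - (K - R) x, y⟫_ℝ = ⟪x, C y - (K - R) y⟫_ℝ := by
    intro x y
    rw [real_inner_comm (C y - (K - R) y) x, hTinner, hTinner, hsymm,
      real_inner_comm (C y - K y) x, mul_comm]
  have hTpos : ∀ x, 0 ≤ ⟪C x - (K - R) x, x⟫_ℝ := fun x => by
    rw [hTinner]; exact add_nonneg (hpos x) (mul_self_nonneg _)
  obtain ⟨e, he⟩ := exists_equiv_of_coercive_sub_compact C (K - R) hc hC hRK (by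
    intro x hx
    have h0 := hTinner x x
    rw [hx, inner_zero_left] at h0
    have h1 := hpos x
    have h2 : ⟪φ, x⟫_ℝ = 0 := by nlinarith [mul_self_nonneg ⟪φ, x⟫_ℝ]
    rw [hTapp, h2, zero_smul, add_zero] at hx
    obtain ⟨r, rfl⟩ := hker x hx
    rw [inner_smul_right, mul_eq_zero, inner_self_eq_zero] at h2
    rw [h2.resolve_right hφ, zero_smul])
  have hesymm : ∀ x y, ⟪e x, y⟫_ℝ = ⟪x, e y⟫_ℝ := fun x y => by rw [he, he, hTsymm]
  have hepos : ∀ x, 0 ≤ ⟪e x, x⟫_ℝ := fun x => by rw [he]; exact hTpos x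
  have hSsymm : ∀ x y, ⟪e.symm x, y⟫_ℝ = ⟪x, e.symm y⟫_ℝ := by
    intro x y
    have := hesymm (e.symm x) (e.symm y)
    rw [e.apply_symm_apply, e.apply_symm_apply] at this
    exact this.symm
  refine ⟨(e.symm : H →L[ℝ] H), hSsymm, ?_, fun x hx => ?_⟩
  · refine exists_coercive_of_equiv e.symm hSsymm fun x => ?_
    have := hepos (e.symm x)
    rwa [e.apply_symm_apply, real_inner_comm] at this
  · have h1 : (C (e.symm x) - K (e.symm x)) + ⟪φ, e.symm x⟫_ℝ • φ = x := by
      rw [← hTapp, ← he, e.apply_symm_apply]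
    have h2 : ⟪φ, e.symm x⟫_ℝ = 0 := by
      have h3 := congrArg (fun z => ⟪φ, z⟫_ℝ) h1
      simp only [inner_add_right, inner_smul_right, hx] at h3
      rw [← hsymm, hφK, inner_zero_left, zero_add, mul_eq_zero, inner_self_eq_zero] at h3
      exact h3.resolve_right hφ
    rw [h2, zero_smul, add_zero] at h1
    exact h1

/-- A real growing mode exists when `⟪φ, L₊⁻¹ φ⟫ > 0`. -/
theorem exists_growing_mode [CompleteSpace H] (A K₁ K₂ : H →L[ℝ] H) {c : ℝ} (hc : 0 < c)
    (hA : ∀ x, c * ‖x‖ ^ 2 ≤ ⟪A x, x⟫_ℝ) (hK₁ : IsCompactOperator K₁)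
    (hK₂ : IsCompactOperator K₂)
    (hsymm₁ : ∀ x y, ⟪A x - K₁ x, y⟫_ℝ = ⟪x, A y - K₁ y⟫_ℝ)
    (hsymm₂ : ∀ x y, ⟪A x - K₂ x, y⟫_ℝ = ⟪x, A y - K₂ y⟫_ℝ)
    (hpos : ∀ x, 0 ≤ ⟪A x - K₂ x, x⟫_ℝ) {φ ψ : H} (hφ : φ ≠ 0) (hφK : A φ - K₂ φ = 0)
    (hker : ∀ x, A x - K₂ x = 0 → ∃ r : ℝ, x = r • φ)
    (hψ : A ψ - K₁ ψ = φ) (hneg : ⟪A φ - K₁ φ, φ⟫_ℝ < 0) (hφψ : 0 < ⟪φ, ψ⟫_ℝ) :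
    ∃ μ : ℝ, 0 < μ ∧ ∃ v w : H, v ≠ 0 ∧ -(A w - K₂ w) = μ • v ∧ A v - K₁ v = μ • w := by
  obtain ⟨S, hSsymm, ⟨s, hs, hS⟩, hSinv⟩ :=
    exists_inverse_on_orthogonal A K₂ hc hA hK₂ hsymm₂ hpos hφ hφK hker
  set X : Submodule ℝ H := (Submodule.span ℝ {φ})ᗮ with hX
  have hmem : ∀ x, x ∈ X ↔ ⟪φ, x⟫_ℝ = 0 := fun x => Submodule.mem_orthogonal_singleton_iff_inner_right
  have hsub : ∀ x : X, compression X A x - compression X K₁ x = compression X (A - K₁) x := by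
    intro x; simp [compression]
  -- With this r, φ - rψ is orthogonal to φ and the form of L₊ there equals ⟪L₊φ, φ⟫ - r‖φ‖² < 0.
  set r := ⟪φ, φ⟫_ℝ / ⟪φ, ψ⟫_ℝ with hr
  have hx₀ : φ - r • ψ ∈ X := by
    rw [hmem, inner_sub_right, inner_smul_right, hr, div_mul_cancel₀ _ hφψ.ne', sub_self]
  have hx₀neg : ⟪compression X A ⟨_, hx₀⟩ - compression X K₁ ⟨_, hx₀⟩, ⟨_, hx₀⟩⟫_ℝ < 0 := by
    rw [hsub, inner_compression_left]
    have h1 : (A - K₁) (φ - r • ψ) = (A φ - K₁ φ) - r • φ := by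
      rw [map_sub, map_smul, sub_apply, sub_apply, hψ]
    have h2 : ⟪φ, φ - r • ψ⟫_ℝ = 0 := (hmem _).1 hx₀
    have h3 : ⟪A φ - K₁ φ, ψ⟫_ℝ = ⟪φ, φ⟫_ℝ := by rw [hsymm₁, hψ]
    have h4 : 0 ≤ r * ⟪φ, φ⟫_ℝ :=
      mul_nonneg (div_nonneg real_inner_self_nonneg hφψ.le) real_inner_self_nonneg
    rw [h1, inner_sub_left, inner_smul_left, h2, mul_zero, sub_zero, inner_sub_right,
      inner_smul_right, h3]
    linarith
  obtain ⟨m, hm, x, hx0, hx⟩ := exists_generalized_eigenvector (compression X A)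
    (compression X K₁) (compression X S) hc hs
    (fun x => by rw [inner_compression_left]; exact hA x)
    (isCompactOperator_compression X hK₁)
    (fun x => by rw [inner_compression_left]; exact hS x)
    (fun x y => by
      rw [hsub, hsub, inner_compression_left, inner_compression_right]; exact hsymm₁ x y)
    (fun x y => by rw [inner_compression_left, inner_compression_right]; exact hSsymm x y)
    hx₀neg
  -- The compressed equation holds modulo φ. As L₋ kills φ and inverts S on φ^⊥, this yields L₋L₊x =
  -- -m x, hence growth rate √m.
  have hmemX : (A x - K₁ x) + m • S x ∈ Submodule.span ℝ {φ} := by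
    have : X.orthogonalProjectionOnto ((A x - K₁ x) + m • S x) = 0 := by
      rw [← hx]; simp [compression]
    rwa [Submodule.orthogonalProjectionOnto_eq_zero_iff,
      Submodule.orthogonal_orthogonal (Submodule.span ℝ {φ})] at this
  obtain ⟨t, ht⟩ := Submodule.mem_span_singleton.1 hmemX
  have hAx : A x - K₁ x = t • φ - m • S x := by rw [ht]; abel
  have hμ : 0 < √m := Real.sqrt_pos.2 hm
  refine ⟨√m, hμ, x, (√m)⁻¹ • (A x - K₁ x), by simpa using hx0, ?_, ?_⟩
  · have h1 : A (A x - K₁ x) - K₂ (A x - K₁ x) = -(m • (x : H)) := by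
      rw [hAx]
      have h2 := hSinv x ((hmem _).1 x.2)
      calc _ = t • (A φ - K₂ φ) - m • (A (S x) - K₂ (S x)) := by
            simp only [map_sub, map_smul, smul_sub]; abel
        _ = _ := by rw [h2, hφK, smul_zero, zero_sub]
    rw [map_smul, map_smul, ← smul_sub, h1, smul_neg, neg_neg, smul_smul]
    congr 1
    rw [inv_mul_eq_div, Real.div_sqrt]
  · rw [smul_smul, mul_inv_cancel₀ hμ.ne', one_smul]

/-- The Vakhitov–Kolokolov index argument: if `L₊` is nonnegative on the orthogonal complement of
`L₊ φ` and `⟪φ, L₊⁻¹ φ⟫ ≤ 0`, then `L₊` is nonnegative on the orthogonal complement of `φ`. -/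
theorem inner_nonneg_of_orthogonal (L : H →L[ℝ] H) (hsymm : ∀ x y, ⟪L x, y⟫_ℝ = ⟪x, L y⟫_ℝ)
    {φ ψ : H} (hφ : φ ≠ 0) (hψ : L ψ = φ) (hφψ : ⟪φ, ψ⟫_ℝ ≤ 0)
    (hpos : ∀ z, ⟪L φ, z⟫_ℝ = 0 → 0 ≤ ⟪L z, z⟫_ℝ) {v : H} (hv : ⟪φ, v⟫_ℝ = 0) :
    0 ≤ ⟪L v, v⟫_ℝ := by
  have h1 : ⟪L φ, ψ⟫_ℝ = ⟪φ, φ⟫_ℝ := by rw [hsymm, hψ]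
  have h2 : ⟪φ, φ⟫_ℝ ≠ 0 := by rwa [Ne, inner_self_eq_zero]
  -- This makes v + βψ orthogonal to Lφ. The cross terms vanish because ⟪Lv, ψ⟫ = ⟪v, φ⟫ = 0,
  -- leaving ⟪Lv, v⟫ + β²⟪φ, ψ⟫ ≥ 0.
  set β := -⟪L φ, v⟫_ℝ / ⟪φ, φ⟫_ℝ with hβ
  have h3 := hpos (v + β • ψ) (by
    rw [inner_add_right, inner_smul_right, h1, hβ, div_mul_cancel₀ _ h2, add_neg_cancel])
  have h4 : ⟪L v, ψ⟫_ℝ = 0 := by rw [hsymm, hψ, real_inner_comm, hv]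
  simp only [map_add, map_smul, inner_add_left, inner_add_right, inner_smul_left,
    inner_smul_right, h4, hψ, hv, RCLike.conj_to_real] at h3
  nlinarith [mul_nonpos_of_nonneg_of_nonpos (mul_self_nonneg β) hφψ]

/-- Absence of growing modes, with the complex eigenvalue problem split into its real and imaginary
parts. -/
theorem eq_zero_of_growing_mode (L M : H →L[ℝ] H)
    (hL : ∀ x y, ⟪L x, y⟫_ℝ = ⟪x, L y⟫_ℝ) (hM : ∀ x y, ⟪M x, y⟫_ℝ = ⟪x, M y⟫_ℝ)
    (hMpos : ∀ x, 0 ≤ ⟪M x, x⟫_ℝ) {φ : H} (hφ : M φ = 0)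
    (hLpos : ∀ v, ⟪φ, v⟫_ℝ = 0 → 0 ≤ ⟪L v, v⟫_ℝ) {α β : ℝ} (hα : 0 < α) {v₁ v₂ w₁ w₂ : H}
    (h₁ : -M w₁ = α • v₁ - β • v₂) (h₂ : -M w₂ = α • v₂ + β • v₁)
    (h₃ : L v₁ = α • w₁ - β • w₂) (h₄ : L v₂ = α • w₂ + β • w₁) :
    v₁ = 0 ∧ v₂ = 0 ∧ w₁ = 0 ∧ w₂ = 0 := by
  -- This is (α + iβ)(x + iy) = 0 in real coordinates.
  have key : ∀ x y : H, α • x - β • y = 0 → α • y + β • x = 0 → x = 0 ∧ y = 0 := by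
    intro x y hx hy
    have hx' : (α ^ 2 + β ^ 2) • x = 0 := by
      calc (α ^ 2 + β ^ 2) • x = α • (α • x - β • y) + β • (α • y + β • x) := by module
        _ = 0 := by rw [hx, hy]; simp
    have hy' : (α ^ 2 + β ^ 2) • y = 0 := by
      calc (α ^ 2 + β ^ 2) • y = α • (α • y + β • x) - β • (α • x - β • y) := by module
        _ = 0 := by rw [hx, hy]; simp
    have : α ^ 2 + β ^ 2 ≠ 0 := by positivity
    exact ⟨(smul_eq_zero.1 hx').resolve_left this, (smul_eq_zero.1 hy').resolve_left this⟩
  have hort : ∀ w, ⟪φ, M w⟫_ℝ = 0 := fun w => by rw [← hM, hφ, inner_zero_left]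
  have hv : ⟪φ, v₁⟫_ℝ = 0 ∧ ⟪φ, v₂⟫_ℝ = 0 := by
    have e1 : α * ⟪φ, v₁⟫_ℝ - β * ⟪φ, v₂⟫_ℝ = 0 := by
      rw [← inner_smul_right, ← inner_smul_right, ← inner_sub_right, ← h₁, inner_neg_right, hort,
        neg_zero]
    have e2 : α * ⟪φ, v₂⟫_ℝ + β * ⟪φ, v₁⟫_ℝ = 0 := by
      rw [← inner_smul_right, ← inner_smul_right, ← inner_add_right, ← h₂, inner_neg_right, hort,
        neg_zero]
    have hne : α ^ 2 + β ^ 2 ≠ 0 := by positivity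
    constructor
    · refine (mul_eq_zero.1 ?_).resolve_left hne
      linear_combination α * e1 + β * e2
    · refine (mul_eq_zero.1 ?_).resolve_left hne
      linear_combination α * e2 - β * e1
  have inL : ∀ x a b : H, ∀ s t : ℝ, ⟪s • a - t • b, x⟫_ℝ = s * ⟪x, a⟫_ℝ - t * ⟪x, b⟫_ℝ := by
    intro x a b s t
    rw [real_inner_comm, inner_sub_right, inner_smul_right, inner_smul_right]
  have inL' : ∀ x a b : H, ∀ s t : ℝ, ⟪s • a + t • b, x⟫_ℝ = s * ⟪x, a⟫_ℝ + t * ⟪x, b⟫_ℝ := by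
    intro x a b s t
    rw [real_inner_comm, inner_add_right, inner_smul_right, inner_smul_right]
  have hP₁ := hLpos v₁ hv.1
  have hP₂ := hLpos v₂ hv.2
  have hQ₁ := hMpos w₁
  have hQ₂ := hMpos w₂
  have m₁ : ∀ x, ⟪M w₁, x⟫_ℝ = -(α * ⟪x, v₁⟫_ℝ - β * ⟪x, v₂⟫_ℝ) := fun x => by
    rw [← inL, ← h₁, inner_neg_left, neg_neg]
  have m₂ : ∀ x, ⟪M w₂, x⟫_ℝ = -(α * ⟪x, v₂⟫_ℝ + β * ⟪x, v₁⟫_ℝ) := fun x => by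
    rw [← inL', ← h₂, inner_neg_left, neg_neg]
  have sL : ⟪L v₁, v₂⟫_ℝ = ⟪L v₂, v₁⟫_ℝ := by rw [hL, real_inner_comm]
  have sM : ⟪M w₁, w₂⟫_ℝ = ⟪M w₂, w₁⟫_ℝ := by rw [hM, real_inner_comm]
  rw [m₁, m₂] at sM
  rw [h₃, h₄, inL, inL'] at sL
  rw [h₃, inL, real_inner_comm, real_inner_comm w₂] at hP₁
  rw [h₄, inL', real_inner_comm, real_inner_comm w₁] at hP₂
  rw [real_inner_comm, real_inner_comm w₂, real_inner_comm w₂, real_inner_comm w₁] at sL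
  have e₁ := m₁ w₁
  have e₂ := m₂ w₂
  -- In complex terms, with z = ⟪w, v⟫, both ⟪Lv, v⟫ = μz and ⟪Mw, w⟫ = -μz̄ are real, so Im z = 0
  -- as α > 0. Both being nonnegative, α Re z and -α Re z are too, so Mw = 0.
  have hY : α * (⟪w₁, v₂⟫_ℝ - ⟪w₂, v₁⟫_ℝ) = 0 := by linarith
  have hY' : ⟪w₁, v₂⟫_ℝ - ⟪w₂, v₁⟫_ℝ = 0 := (mul_eq_zero.1 hY).resolve_left hα.ne'
  have hβY : β * (⟪w₁, v₂⟫_ℝ - ⟪w₂, v₁⟫_ℝ) = 0 := by rw [hY', mul_zero]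
  have z₁ : ⟪M w₁, w₁⟫_ℝ = 0 := by nlinarith
  have z₂ : ⟪M w₂, w₂⟫_ℝ = 0 := by nlinarith
  have k₁ := eq_zero_of_inner_self_eq_zero M hM hMpos z₁
  have k₂ := eq_zero_of_inner_self_eq_zero M hM hMpos z₂
  obtain ⟨rfl, rfl⟩ := key v₁ v₂ (by rw [← h₁, k₁, neg_zero]) (by rw [← h₂, k₂, neg_zero])
  obtain ⟨rfl, rfl⟩ := key w₁ w₂ (by rw [← h₃, map_zero]) (by rw [← h₄, map_zero])
  simp

end VakhitovKolokolov

/-! ### Multiplication operators on ℓ² -/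

section Sequences

variable {ι : Type*}

theorem memℓp_two_iff_summable_sq {f : ι → ℝ} :
    Memℓp f 2 ↔ Summable fun n => f n ^ 2 := by
  rw [memℓp_gen_iff (by norm_num)]
  simp

theorem summable_sq (u : lp (fun _ : ι => ℝ) 2) : Summable fun n => u n ^ 2 :=
  memℓp_two_iff_summable_sq.1 (lp.memℓp u)

theorem real_inner_eq_tsum (u v : lp (fun _ : ι => ℝ) 2) : ⟪u, v⟫_ℝ = ∑' n, u n * v n := by
  rw [lp.inner_eq_tsum]
  exact tsum_congr fun n => by simp [mul_comm]

theorem summable_mul (u v : lp (fun _ : ι => ℝ) 2) : Summable fun n => u n * v n := by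
  refine (lp.summable_inner (𝕜 := ℝ) u v).congr fun n => ?_
  simp [mul_comm]

theorem norm_sq_eq_tsum (u : lp (fun _ : ι => ℝ) 2) : ‖u‖ ^ 2 = ∑' n, u n ^ 2 := by
  rw [← real_inner_self_eq_norm_sq, real_inner_eq_tsum]
  exact tsum_congr fun n => by ring

theorem abs_apply_le_norm (u : lp (fun _ : ι => ℝ) 2) (n : ι) : |u n| ≤ ‖u‖ :=
  lp.norm_apply_le_norm two_ne_zero u n

theorem norm_le_of_abs_le {u v : lp (fun _ : ι => ℝ) 2} {M : ℝ} (hM : 0 ≤ M)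
    (h : ∀ n, |v n| ≤ M * |u n|) : ‖v‖ ≤ M * ‖u‖ := by
  refine abs_le_of_sq_le_sq' ?_ (by positivity) |>.2
  rw [mul_pow, norm_sq_eq_tsum, norm_sq_eq_tsum, ← tsum_mul_left]
  refine (summable_sq v).tsum_le_tsum (fun n => ?_) ((summable_sq u).mul_left _)
  rw [← sq_abs (v n), ← sq_abs (u n), ← mul_pow]
  exact pow_le_pow_left₀ (abs_nonneg _) (h n) 2

theorem memℓp_of_abs_le (u : lp (fun _ : ι => ℝ) 2) {f : ι → ℝ} {M : ℝ}
    (h : ∀ n, |f n| ≤ M * |u n|) : Memℓp f 2 := by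
  rw [memℓp_two_iff_summable_sq]
  refine Summable.of_nonneg_of_le (fun n => sq_nonneg _) (fun n => ?_)
    ((summable_sq u).mul_left (M ^ 2))
  rw [← sq_abs (f n), ← sq_abs (u n), ← mul_pow]
  exact pow_le_pow_left₀ (abs_nonneg _) (h n) 2

theorem tendsto_apply_cofinite (u : lp (fun _ : ι => ℝ) 2) :
    Filter.Tendsto (fun n => |u n|) Filter.cofinite (nhds 0) := by
  have := ((summable_sq u).tendsto_cofinite_zero).sqrt
  simpa [Real.sqrt_sq_eq_abs] using this

/-- Multiplication by a bounded sequence. -/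
noncomputable def mulOp (m : ι → ℝ) (M : ℝ) (hm : ∀ n, |m n| ≤ M) :
    lp (fun _ : ι => ℝ) 2 →L[ℝ] lp (fun _ : ι => ℝ) 2 :=
  have h : ∀ (u : lp (fun _ : ι => ℝ) 2) n, |m n * u n| ≤ |M| * |u n| := fun u n => by
    rw [abs_mul]
    exact mul_le_mul_of_nonneg_right ((hm n).trans (le_abs_self M)) (abs_nonneg _)
  LinearMap.mkContinuous
    { toFun := fun u => ⟨fun n => m n * u n, memℓp_of_abs_le u (h u)⟩
      map_add' := fun u v => lp.ext (funext fun n => mul_add (m n) (u n) (v n))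
      map_smul' := fun c u => lp.ext (funext fun n => mul_left_comm (m n) c (u n)) }
    |M| fun u => norm_le_of_abs_le (abs_nonneg M) (h u)

@[simp] theorem mulOp_apply (m : ι → ℝ) (M : ℝ) (hm : ∀ n, |m n| ≤ M)
    (u : lp (fun _ : ι => ℝ) 2) (n : ι) : mulOp m M hm u n = m n * u n := rfl

theorem inner_mulOp (m : ι → ℝ) (M : ℝ) (hm : ∀ n, |m n| ≤ M) (u v : lp (fun _ : ι => ℝ) 2) :
    ⟪mulOp m M hm u, v⟫_ℝ = ∑' n, m n * (u n * v n) := by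
  rw [real_inner_eq_tsum]
  exact tsum_congr fun n => by simp [mul_assoc]

theorem mulOp_symm (m : ι → ℝ) (M : ℝ) (hm : ∀ n, |m n| ≤ M) (u v : lp (fun _ : ι => ℝ) 2) :
    ⟪mulOp m M hm u, v⟫_ℝ = ⟪u, mulOp m M hm v⟫_ℝ := by
  rw [real_inner_comm (mulOp m M hm v), inner_mulOp, inner_mulOp]
  exact tsum_congr fun n => by ring

/-- Multiplication by a sequence tending to zero is compact. -/
theorem isCompactOperator_mulOp (m : ι → ℝ) (M : ℝ) (hm : ∀ n, |m n| ≤ M)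
    (h0 : Filter.Tendsto m Filter.cofinite (nhds 0)) : IsCompactOperator (mulOp m M hm) := by
  classical
  -- Truncations to finite sets of indices have finite rank and converge in operator norm, because m
  -- is small off a finite set.
  set F : Finset ι → lp (fun _ : ι => ℝ) 2 →L[ℝ] lp (fun _ : ι => ℝ) 2 := fun s =>
    ∑ n ∈ s, m n • (lp.singleContinuousLinearMap ℝ (fun _ : ι => ℝ) 2 n).comp
      (lp.evalCLM ℝ (fun _ : ι => ℝ) 2 n) with hF
  have hFapp : ∀ s u k, F s u k = if k ∈ s then m k * u k else 0 := by
    intro s u k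
    have h1 : F s u = ∑ n ∈ s, m n • lp.single 2 n (u n) := by
      simp only [hF, sum_apply]
      rfl
    rw [h1, lp.coeFn_sum, Finset.sum_apply]
    simp only [lp.coeFn_smul, Pi.smul_apply, lp.single_apply, smul_eq_mul]
    split_ifs with hk
    · rw [Finset.sum_eq_single_of_mem k hk]
      · simp
      · intro b _ hb
        simp [Pi.single_eq_of_ne hb.symm]
    · refine Finset.sum_eq_zero fun b hb => ?_
      rw [Pi.single_eq_of_ne (by rintro rfl; exact hk hb), mul_zero]
  refine isCompactOperator_of_tendsto (l := Filter.atTop) (F := F) ?_ (.of_forall fun s => ?_)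
  · rw [Metric.tendsto_atTop]
    intro ε hε
    have hfin : {n | ¬ |m n| < ε / 2}.Finite := by
      have := (Metric.tendsto_nhds.1 h0) (ε / 2) (by positivity)
      simpa [Filter.eventually_cofinite] using this
    refine ⟨hfin.toFinset, fun s hs => ?_⟩
    rw [dist_eq_norm]
    refine lt_of_le_of_lt (ContinuousLinearMap.opNorm_le_bound _ (by positivity : 0 ≤ ε / 2)
      fun u => norm_le_of_abs_le (by positivity) fun n => ?_) (half_lt_self hε)
    rw [sub_apply, lp.coeFn_sub, Pi.sub_apply, hFapp, mulOp_apply]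
    split_ifs with hn
    · simp only [sub_self, abs_zero]; positivity
    · rw [zero_sub, abs_neg, abs_mul]
      gcongr
      by_contra! hlt
      exact hn (hs (by simpa using hlt.le))
  · simp only [hF]
    refine Submodule.sum_mem (compactOperator (RingHom.id ℝ) _ _) fun n _ => ?_
    refine Submodule.smul_mem _ _ ?_
    have : IsCompactOperator (lp.singleContinuousLinearMap ℝ (fun _ : ι => ℝ) 2 n) :=
      isCompactOperator_of_locallyCompactSpace_rng _
    exact this.comp_clm _

end Sequences

/-! ### The discrete Schrödinger operator and its quadratic form -/

section Lattice

variable {d : ℕ}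

theorem memℓp_shift (k : Fin d → ℤ) (u : EllTwo d ℝ) : Memℓp (fun n => u (n + k)) 2 := by
  rw [memℓp_two_iff_summable_sq]
  exact (summable_sq u).comp_injective (Equiv.addRight k).injective

/-- Translation by a lattice vector. -/
noncomputable def shift (k : Fin d → ℤ) : EllTwo d ℝ →L[ℝ] EllTwo d ℝ :=
  LinearMap.mkContinuous
    { toFun := fun u => ⟨fun n => u (n + k), memℓp_shift k u⟩
      map_add' := fun u v => rfl
      map_smul' := fun c u => rfl }
    1 fun u => by
      rw [one_mul]
      refine abs_le_of_sq_le_sq' ?_ (norm_nonneg u) |>.2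
      rw [norm_sq_eq_tsum, norm_sq_eq_tsum]
      exact ((Equiv.addRight k).tsum_eq fun n => u n ^ 2).le

@[simp] theorem shift_apply (k : Fin d → ℤ) (u : EllTwo d ℝ) (n : Fin d → ℤ) :
    shift k u n = u (n + k) := rfl

theorem inner_shift_shift (k : Fin d → ℤ) (u v : EllTwo d ℝ) :
    ⟪shift k u, shift k v⟫_ℝ = ⟪u, v⟫_ℝ := by
  rw [real_inner_eq_tsum, real_inner_eq_tsum]
  exact (Equiv.addRight k).tsum_eq fun n => u n * v n

theorem inner_shift_neg (k : Fin d → ℤ) (u v : EllTwo d ℝ) :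
    ⟪shift (-k) u, v⟫_ℝ = ⟪u, shift k v⟫_ℝ := by
  rw [← inner_shift_shift k]
  congr 1
  ext n
  simp

/-- The operator `-Δ + ω`. -/
noncomputable def schrodinger (d : ℕ) (ω : ℝ) : EllTwo d ℝ →L[ℝ] EllTwo d ℝ :=
  ω • ContinuousLinearMap.id ℝ _ +
    ∑ i : Fin d, ((2 : ℝ) • ContinuousLinearMap.id ℝ _ - shift (e i) - shift (-e i))

theorem schrodinger_eq (ω : ℝ) (u : EllTwo d ℝ) :
    schrodinger d ω u = ω • u + ∑ i : Fin d, ((2 : ℝ) • u - shift (e i) u - shift (-e i) u) := by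
  simp only [schrodinger, add_apply, sum_apply, sub_apply, smul_apply,
    ContinuousLinearMap.id_apply]

theorem schrodinger_apply (ω : ℝ) (u : EllTwo d ℝ) (n : Fin d → ℤ) :
    schrodinger d ω u n = -discLaplacian (⇑u) n + ω • u n := by
  rw [schrodinger_eq, lp.coeFn_add, Pi.add_apply, lp.coeFn_sum, Finset.sum_apply]
  simp only [lp.coeFn_sub, lp.coeFn_smul, Pi.sub_apply, Pi.smul_apply, shift_apply, smul_eq_mul,
    discLaplacian, Finset.sum_sub_distrib, Finset.sum_add_distrib, Finset.sum_const,
    Finset.card_univ, Fintype.card_fin, nsmul_eq_mul, ← sub_eq_add_neg]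
  ring

theorem schrodinger_add_freq (ω s : ℝ) (u : EllTwo d ℝ) :
    schrodinger d s u = schrodinger d ω u + (s - ω) • u := by
  rw [schrodinger_eq, schrodinger_eq]
  module

/-- Summation by parts: with T a unit shift, which is unitary, 2 - T - T⁻¹ = (T - 1)*(T - 1). -/
theorem inner_schrodinger (ω : ℝ) (u v : EllTwo d ℝ) :
    ⟪schrodinger d ω u, v⟫_ℝ =
      (∑ i : Fin d, ⟪shift (e i) u - u, shift (e i) v - v⟫_ℝ) + ω * ⟪u, v⟫_ℝ := by
  rw [schrodinger_eq, inner_add_left, inner_smul_left, sum_inner, add_comm]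
  congr 1
  refine Finset.sum_congr rfl fun i _ => ?_
  simp only [inner_sub_left, inner_sub_right, inner_smul_left, inner_shift_shift, inner_shift_neg,
    RCLike.conj_to_real]
  ring

theorem schrodinger_symm (ω : ℝ) (u v : EllTwo d ℝ) :
    ⟪schrodinger d ω u, v⟫_ℝ = ⟪u, schrodinger d ω v⟫_ℝ := by
  rw [real_inner_comm (schrodinger d ω v), inner_schrodinger, inner_schrodinger,
    real_inner_comm v u]
  congr 1
  exact Finset.sum_congr rfl fun i _ => real_inner_comm _ _

theorem J_eq (ω : ℝ) (u : EllTwo d ℝ) : J ω u = ⟪schrodinger d ω u, u⟫_ℝ := by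
  rw [inner_schrodinger, J]
  congr 1
  · rw [Summable.tsum_finsetSum]
    · refine Finset.sum_congr rfl fun i _ => ?_
      rw [real_inner_self_eq_norm_sq, norm_sq_eq_tsum]
      exact tsum_congr fun n => by simp
    · intro i _
      refine (summable_sq (shift (e i) u - u)).congr fun n => by simp
  · rw [real_inner_self_eq_norm_sq, norm_sq_eq_tsum]
    simp

theorem schrodinger_coercive {ω : ℝ} (u : EllTwo d ℝ) :
    ω * ‖u‖ ^ 2 ≤ ⟪schrodinger d ω u, u⟫_ℝ := by
  rw [inner_schrodinger, real_inner_self_eq_norm_sq]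
  have : 0 ≤ ∑ i : Fin d, ⟪shift (e i) u - u, shift (e i) u - u⟫_ℝ :=
    Finset.sum_nonneg fun i _ => real_inner_self_nonneg
  linarith

/-- The sequence of absolute values. -/
noncomputable def absSeq (u : EllTwo d ℝ) : EllTwo d ℝ :=
  ⟨fun n => |u n|, memℓp_of_abs_le u (M := 1) fun n => by simp⟩

@[simp] theorem absSeq_apply (u : EllTwo d ℝ) (n : Fin d → ℤ) : absSeq u n = |u n| := rfl

/-- The reverse triangle inequality on each bond. It puts |w| in the kernel of L₋ whenever w is. -/
theorem inner_schrodinger_absSeq_le (ω : ℝ) (u : EllTwo d ℝ) :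
    ⟪schrodinger d ω (absSeq u), absSeq u⟫_ℝ ≤ ⟪schrodinger d ω u, u⟫_ℝ := by
  rw [inner_schrodinger, inner_schrodinger]
  have h : ⟪absSeq u, absSeq u⟫_ℝ = ⟪u, u⟫_ℝ := by
    rw [real_inner_eq_tsum, real_inner_eq_tsum]
    exact tsum_congr fun n => by simp
  rw [h]
  gcongr with i
  rw [real_inner_self_eq_norm_sq, real_inner_self_eq_norm_sq]
  have := norm_le_of_abs_le (u := shift (e i) u - u) (v := shift (e i) (absSeq u) - absSeq u)
    zero_le_one fun n => by simpa using abs_abs_sub_abs_le (u (n + e i)) (u n)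
  rw [one_mul] at this
  gcongr

/-- A set of lattice sites closed under passing to nearest neighbours is everything. -/
theorem forall_of_neighbors {p : (Fin d → ℤ) → Prop} {n₀ : Fin d → ℤ} (h₀ : p n₀)
    (hp : ∀ n, p n → ∀ i, p (n + e i) ∧ p (n - e i)) (n : Fin d → ℤ) : p n := by
  -- The translations k for which both k and -k preserve p form a subgroup, and it contains the
  -- generators of ℤ^d.
  set G : AddSubgroup (Fin d → ℤ) :=
    { carrier := {k | ∀ n, p n → p (n + k) ∧ p (n - k)}
      zero_mem' := fun n hn => by simpa using hn
      add_mem' := fun {k l} hk hl n hn => by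
        refine ⟨?_, ?_⟩
        · rw [← add_assoc]; exact (hl _ (hk n hn).1).1
        · rw [← sub_sub]; exact (hl _ (hk n hn).2).2
      neg_mem' := fun {k} hk n hn => by
        rw [← sub_eq_add_neg, sub_neg_eq_add]; exact (hk n hn).symm } with hG
  have he : ∀ i, e i ∈ G := fun i n hn => hp n hn i
  have hmem : ∀ k, k ∈ G := by
    intro k
    have : k = ∑ i, k i • e i := by
      ext j
      simp [e, Finset.sum_apply, Pi.single_apply]
    rw [this]
    exact G.sum_mem fun i _ => G.zsmul_mem (he i) _
  simpa using (hmem (n - n₀) n₀ h₀).1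

end Lattice

/-! ### Calculus of |x|^r and |x|^r x, uniform on bounded sets -/

section PowerFunction

/-- At 0 the difference quotient is |y|^r, which tends to 0, so every r > 0 is allowed. With r = 2σ
this derivative is the potential of L₊. -/
theorem hasDerivAt_abs_rpow_mul_self {r : ℝ} (hr : 0 < r) (x : ℝ) :
    HasDerivAt (fun y : ℝ => |y| ^ r * y) ((r + 1) * |x| ^ r) x := by
  rcases eq_or_ne x 0 with rfl | hx
  · rw [hasDerivAt_iff_tendsto_slope]
    have h : Filter.Tendsto (fun y : ℝ => |y| ^ r) (nhdsWithin 0 {0}ᶜ) (nhds 0) := by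
      have hc : Continuous fun y : ℝ => |y| ^ r :=
        continuous_abs.rpow_const fun _ => Or.inr hr.le
      have := (hc.tendsto 0).mono_left (nhdsWithin_le_nhds (s := {0}ᶜ))
      simpa [Real.zero_rpow hr.ne'] using this
    simp only [abs_zero, Real.zero_rpow hr.ne', mul_zero]
    refine h.congr' ?_
    filter_upwards [self_mem_nhdsWithin] with y hy
    have hy' : y ≠ 0 := hy
    simp [slope_def_field, hy']
  · have h := ((hasDerivAt_abs hx).rpow_const (p := r) (Or.inl (abs_ne_zero.2 hx))).mul
      (hasDerivAt_id x)
    refine HasDerivAt.congr_deriv h ?_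
    have h1 : |x| ^ r = |x| ^ (r - 1) * |x| := by
      rw [← Real.rpow_add_one (abs_ne_zero.2 hx), sub_add_cancel]
    have h2 : (SignType.sign x : ℝ) * x = |x| := sign_mul_self x
    simp only [id_eq, mul_one]
    rw [mul_right_comm _ _ x, mul_right_comm _ _ x, h2, h1]
    ring

/-- The first-order Taylor remainder of `|y|^r y` is small, uniformly on bounded sets. -/
theorem exists_abs_rpow_mul_self_remainder {r : ℝ} (hr : 0 < r) (M : ℝ) {ε : ℝ} (hε : 0 < ε) :
    ∃ δ > 0, ∀ x y : ℝ, |x| ≤ M → |y - x| < δ →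
      |(|y| ^ r * y - |x| ^ r * x - (r + 1) * |x| ^ r * (y - x))| ≤ ε * |y - x| := by
  set k : ℝ → ℝ := fun x => (r + 1) * |x| ^ r with hk
  have hkc : Continuous k :=
    continuous_const.mul (continuous_abs.rpow_const fun _ => Or.inr hr.le)
  have huc := (isCompact_Icc (a := -(M + 1)) (b := M + 1)).uniformContinuousOn_of_continuous
    hkc.continuousOn
  obtain ⟨δ, hδ, h⟩ := Metric.uniformContinuousOn_iff.1 huc ε hε
  refine ⟨min δ 1, by positivity, fun x y hx hxy => ?_⟩
  have hb : ∀ z ∈ Metric.ball x (min δ 1), ‖k z - k x‖ ≤ ε := by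
    intro z hz
    rw [Metric.mem_ball, lt_min_iff] at hz
    have h1 := abs_lt.1 (Real.dist_eq z x ▸ hz.2)
    have h2 := abs_le.1 hx
    rw [← dist_eq_norm]
    exact (h z ⟨by linarith, by linarith⟩ x ⟨by linarith, by linarith⟩ hz.1).le
  -- Mean value inequality for |z|^r z - k(x) z, whose derivative k(z) - k(x) is small by uniform
  -- continuity of k.
  have hd : ∀ z ∈ Metric.ball x (min δ 1),
      HasDerivWithinAt (fun z => |z| ^ r * z - k x * z) (k z - k x)
        (Metric.ball x (min δ 1)) z := by
    intro z _
    have := (hasDerivAt_abs_rpow_mul_self hr z).sub ((hasDerivAt_id z).const_mul (k x))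
    rw [mul_one] at this
    exact this.hasDerivWithinAt
  have := (convex_ball x (min δ 1)).norm_image_sub_le_of_norm_hasDerivWithin_le hd hb
    (Metric.mem_ball_self (by positivity)) (show y ∈ _ by rwa [Metric.mem_ball, Real.dist_eq])
  rw [Real.norm_eq_abs, Real.norm_eq_abs] at this
  convert this using 2
  simp only [hk]
  ring

/-- The second-order Taylor expansion of `|y|^(r+2)`, uniformly on bounded sets. -/
theorem exists_abs_rpow_remainder {r : ℝ} (hr : 0 < r) (M : ℝ) {ε : ℝ} (hε : 0 < ε) :
    ∃ δ > 0, ∀ x h : ℝ, |x| ≤ M → |h| < δ →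
      |x| ^ (r + 2) + (r + 2) * (|x| ^ r * x * h) +
        (r + 2) / 2 * ((r + 1) * |x| ^ r * h ^ 2 - ε * h ^ 2) ≤ |x + h| ^ (r + 2) := by
  obtain ⟨δ, hδ, H⟩ := exists_abs_rpow_mul_self_remainder hr M (half_pos hε)
  refine ⟨δ, hδ, fun x h hx hh => ?_⟩
  set s := Metric.closedBall x |h| with hs
  set k := (r + 1) * |x| ^ r with hk
  have hb : ∀ z ∈ s, ‖(r + 2) * (|z| ^ r * z - |x| ^ r * x - k * (z - x))‖ ≤
      (r + 2) * (ε / 2 * |h|) := by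
    intro z hz
    have hz' : |z - x| ≤ |h| := by rwa [hs, Metric.mem_closedBall, Real.dist_eq] at hz
    rw [norm_mul, Real.norm_of_nonneg (by positivity), Real.norm_eq_abs]
    gcongr
    exact (H x z hx (hz'.trans_lt hh)).trans (by gcongr)
  -- The derivative of |z|^(r+2) is (r+2)|z|^r z, so integrating the first-order remainder gives the
  -- second-order expansion.
  have hd : ∀ z ∈ s, HasDerivWithinAt
      (fun z => |z| ^ (r + 2) - (r + 2) * (|x| ^ r * x * (z - x) + k / 2 * (z - x) ^ 2))
      ((r + 2) * (|z| ^ r * z - |x| ^ r * x - k * (z - x))) s z := by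
    intro z _
    have h1 := hasDerivAt_abs_rpow z (p := r + 2) (by linarith)
    have h2 : HasDerivAt (fun z : ℝ => z - x) 1 z := (hasDerivAt_id z).sub_const x
    have h3 := h1.sub (((h2.const_mul (|x| ^ r * x)).add
      ((h2.pow 2).const_mul (k / 2))).const_mul (r + 2))
    refine (h3.congr_deriv ?_).hasDerivWithinAt
    rw [add_sub_cancel_right]
    push_cast
    ring
  have := (convex_closedBall x |h|).norm_image_sub_le_of_norm_hasDerivWithin_le hd hb
    (Metric.mem_closedBall_self (abs_nonneg h))
    (show x + h ∈ s by rw [hs, Metric.mem_closedBall, Real.dist_eq, add_sub_cancel_left])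
  rw [Real.norm_eq_abs, Real.norm_eq_abs, add_sub_cancel_left, sub_self] at this
  have h4 := (abs_le.1 this).1
  have h5 : |h| * |h| = h ^ 2 := by rw [← abs_mul, ← pow_two, abs_sq]
  have h6 : (r + 2) * (ε / 2 * |h|) * |h| = (r + 2) / 2 * (ε * h ^ 2) := by rw [← h5]; ring
  rw [h6] at h4
  simp only [hk] at h4
  linarith

/-- Young's inequality in the form used for the linearized operator. -/
theorem abs_rpow_mul_sq_le {σ : ℝ} (hσ : 0 < σ) (x y : ℝ) :
    |x| ^ (2 * σ) * y ^ 2 ≤ σ / (σ + 1) * |x| ^ (2 * σ + 2) + 1 / (σ + 1) * |y| ^ (2 * σ + 2) := by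
  have h := Real.geom_mean_le_arith_mean2_weighted (w₁ := σ / (σ + 1)) (w₂ := 1 / (σ + 1))
    (p₁ := |x| ^ (2 * σ + 2)) (p₂ := |y| ^ (2 * σ + 2)) (by positivity) (by positivity)
    (by positivity) (by positivity) (by field_simp)
  rw [← Real.rpow_mul (abs_nonneg x), ← Real.rpow_mul (abs_nonneg y)] at h
  have e1 : (2 * σ + 2) * (σ / (σ + 1)) = 2 * σ := by field_simp
  have e2 : (2 * σ + 2) * (1 / (σ + 1)) = 2 := by field_simp
  rw [e1, e2, Real.rpow_two, sq_abs] at h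
  exact h

/-- A function vanishing at `0` and nonnegative to the right of `0` has nonnegative derivative. -/
theorem deriv_nonneg_of_eventually {h : ℝ → ℝ} {D : ℝ} (hD : HasDerivAt h D 0) (h0 : h 0 = 0)
    (hev : ∀ᶠ s in nhdsWithin 0 (Set.Ioi 0), 0 ≤ h s) : 0 ≤ D := by
  have ht := (hasDerivAt_iff_tendsto_slope.1 hD).mono_left
    (nhdsWithin_mono 0 (show Set.Ioi (0 : ℝ) ⊆ {0}ᶜ from fun s (hs : 0 < s) => hs.ne'))
  refine ge_of_tendsto ht ?_
  filter_upwards [hev, self_mem_nhdsWithin] with s hs hs0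
  rw [slope_def_field, h0]
  have : (0 : ℝ) < s := hs0
  rw [sub_zero, sub_zero]
  positivity

end PowerFunction

/-! ### Variational consequences of optimality -/

section Variational

variable {d : ℕ} {σ ω : ℝ}

theorem summable_abs_rpow (hσ : 0 < σ) (u : EllTwo d ℝ) :
    Summable fun n => |u n| ^ (2 * σ + 2) := by
  refine Summable.of_nonneg_of_le (fun n => by positivity) (fun n => ?_)
    ((summable_sq u).mul_left (‖u‖ ^ (2 * σ)))
  rw [Real.rpow_add_of_nonneg (abs_nonneg _) (by positivity) (by norm_num), Real.rpow_two, sq_abs]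
  gcongr
  exact abs_apply_le_norm u n

/-- Multiplication by `|φ|^(2σ)`. -/
noncomputable def potential (σ : ℝ) (hσ : 0 < σ) (φ : EllTwo d ℝ) :
    EllTwo d ℝ →L[ℝ] EllTwo d ℝ :=
  mulOp (fun n => |φ n| ^ (2 * σ)) (‖φ‖ ^ (2 * σ)) fun n => by
    rw [abs_of_nonneg (by positivity)]
    gcongr
    exact abs_apply_le_norm φ n

theorem potential_apply (hσ : 0 < σ) (φ u : EllTwo d ℝ) (n : Fin d → ℤ) :
    potential σ hσ φ u n = |φ n| ^ (2 * σ) * u n := rfl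

theorem potential_symm (hσ : 0 < σ) (φ u v : EllTwo d ℝ) :
    ⟪potential σ hσ φ u, v⟫_ℝ = ⟪u, potential σ hσ φ v⟫_ℝ := mulOp_symm _ _ _ u v

theorem inner_potential (hσ : 0 < σ) (φ u v : EllTwo d ℝ) :
    ⟪potential σ hσ φ u, v⟫_ℝ = ∑' n, |φ n| ^ (2 * σ) * (u n * v n) := inner_mulOp _ _ _ u v

theorem summable_potential (hσ : 0 < σ) (φ u v : EllTwo d ℝ) :
    Summable fun n => |φ n| ^ (2 * σ) * (u n * v n) := by
  refine (summable_mul (potential σ hσ φ u) v).congr fun n => ?_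
  rw [potential_apply, mul_assoc]

theorem isCompactOperator_potential (hσ : 0 < σ) (φ : EllTwo d ℝ) :
    IsCompactOperator (potential σ hσ φ) := by
  refine isCompactOperator_mulOp _ _ _ ?_
  have hc : ContinuousAt (fun y : ℝ => y ^ (2 * σ)) 0 :=
    Real.continuousAt_rpow_const _ _ (Or.inr (by positivity))
  have := hc.tendsto.comp (tendsto_apply_cofinite φ)
  rwa [Real.zero_rpow (by positivity)] at this

theorem inner_potential_self (hσ : 0 < σ) (φ : EllTwo d ℝ) :
    ⟪potential σ hσ φ φ, φ⟫_ℝ = ∑' n, |φ n| ^ (2 * σ + 2) := by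
  rw [inner_potential]
  refine tsum_congr fun n => ?_
  rw [Real.rpow_add_of_nonneg (abs_nonneg _) (by positivity) (by norm_num), Real.rpow_two, sq_abs]
  ring

/-- Second-order lower bound for `∑ |φ + t z|^(2σ+2)`. -/
theorem eventually_tsum_abs_rpow_ge (hσ : 0 < σ) (φ z : EllTwo d ℝ) {ε : ℝ} (hε : 0 < ε) :
    ∀ᶠ t : ℝ in nhds 0, (∑' n, |φ n| ^ (2 * σ + 2)) +
      t * ((2 * σ + 2) * ⟪potential σ hσ φ φ, z⟫_ℝ) +
      t ^ 2 * ((σ + 1) * ((2 * σ + 1) * ⟪potential σ hσ φ z, z⟫_ℝ - ε * ‖z‖ ^ 2)) ≤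
      ∑' n, |(φ + t • z) n| ^ (2 * σ + 2) := by
  obtain ⟨δ, hδ, H⟩ := exists_abs_rpow_remainder (r := 2 * σ) (by positivity) ‖φ‖ hε
  have hev : ∀ᶠ t : ℝ in nhds 0, |t| * ‖z‖ < δ := by
    have hc : Continuous fun t : ℝ => |t| * ‖z‖ := by fun_prop
    exact (hc.tendsto 0).eventually (gt_mem_nhds (by simpa using hδ))
  filter_upwards [hev] with t ht
  rw [inner_potential, inner_potential, norm_sq_eq_tsum]
  have s₁ := summable_abs_rpow hσ φ
  have s₂ := summable_potential hσ φ φ z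
  have s₃ := summable_potential hσ φ z z
  have s₄ := summable_sq z
  have hs := ((s₁.hasSum.add ((s₂.hasSum.mul_left (2 * σ + 2)).mul_left t)).add
    ((((s₃.hasSum.mul_left (2 * σ + 1)).sub (s₄.hasSum.mul_left ε)).mul_left (σ + 1)).mul_left
      (t ^ 2)))
  refine hasSum_le (fun n => ?_) hs (summable_abs_rpow hσ (φ + t • z)).hasSum
  have h := H (φ n) (t * z n) (abs_apply_le_norm φ n) (by
    rw [abs_mul]
    exact (mul_le_mul_of_nonneg_left (abs_apply_le_norm z n) (abs_nonneg t)).trans_lt ht)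
  refine le_trans (le_of_eq ?_) h
  ring

/-- A rescaled optimizer of the discrete Gagliardo–Nirenberg-type inequality, normalized so that
the energy `J` equals `∑ |φ|^(2σ+2)`. -/
structure IsOptimizer (σ ω : ℝ) (φ : EllTwo d ℝ) : Prop where
  energy_pos : 0 < J ω φ
  power_eq : ∑' n, |φ n| ^ (2 * σ + 2) = J ω φ
  power_le : ∀ v : EllTwo d ℝ, ∑' n, |v n| ^ (2 * σ + 2) ≤ J ω φ * (J ω v / J ω φ) ^ (σ + 1)

theorem J_smul (c : ℝ) (u : EllTwo d ℝ) : J ω (c • u) = c ^ 2 * J ω u := by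
  rw [J_eq, J_eq, map_smul, inner_smul_left, inner_smul_right, pow_two, mul_assoc]
  rfl

theorem J_add_smul (t : ℝ) (u z : EllTwo d ℝ) :
    J ω (u + t • z) = J ω u + t * (2 * ⟪schrodinger d ω u, z⟫_ℝ) + t ^ 2 * J ω z := by
  simp only [J_eq, map_add, map_smul, inner_add_left, inner_add_right, inner_smul_left,
    inner_smul_right, RCLike.conj_to_real]
  rw [schrodinger_symm ω z u, real_inner_comm (schrodinger d ω u) z]
  ring

theorem tsum_smul_abs_rpow {c : ℝ} (hc : 0 ≤ c) (u : EllTwo d ℝ) :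
    ∑' n, |(c • u) n| ^ (2 * σ + 2) = c ^ (2 * σ + 2) * ∑' n, |u n| ^ (2 * σ + 2) := by
  rw [← tsum_mul_left]
  refine tsum_congr fun n => ?_
  rw [lp.coeFn_smul, Pi.smul_apply, smul_eq_mul, abs_mul, abs_of_nonneg hc,
    Real.mul_rpow hc (abs_nonneg _)]

theorem J_pos (hω : 0 < ω) {u : EllTwo d ℝ} (hu : u ≠ 0) : 0 < J ω u := by
  rw [J_eq]
  have : 0 < ‖u‖ := norm_pos_iff.2 hu
  exact lt_of_lt_of_le (by positivity) (schrodinger_coercive u)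

theorem J_nonneg (hω : 0 < ω) (u : EllTwo d ℝ) : 0 ≤ J ω u := by
  rw [J_eq]
  exact le_trans (by positivity) (schrodinger_coercive u)

/-- The factor j^(1/(2σ)) is the one that makes J[φ] and ∑|φ|^(2σ+2) both equal to j^((σ+1)/σ).
Scaling any v with nonzero power sum onto the constraint set gives the inequality. -/
theorem IsHomogeneousWave.isOptimizer (hσ : 0 < σ) (hω : 0 < ω) {φ : EllTwo d ℝ}
    (h : IsHomogeneousWave σ ω φ) : IsOptimizer σ ω φ := by
  obtain ⟨u, ⟨huc, humin⟩, rfl⟩ := h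
  have huc' : ∑' n, |u n| ^ (2 * σ + 2) = 1 := huc
  have hj : jmin d σ ω = J ω u := by
    refine IsLeast.csInf_eq ⟨⟨u, huc, rfl⟩, ?_⟩
    rintro _ ⟨v, hv, rfl⟩
    exact humin v hv
  have hu0 : u ≠ 0 := by
    rintro rfl
    simp [Real.zero_rpow (show 2 * σ + 2 ≠ 0 by positivity)] at huc'
  have hJ : 0 < J ω u := J_pos hω hu0
  rw [hj]
  set j := J ω u with hjdef
  have hS : J ω (j ^ (1 / (2 * σ)) • u) = j ^ ((σ + 1) / σ) := by
    rw [J_smul, ← hjdef, ← Real.rpow_mul_natCast hJ.le, ← Real.rpow_add_one hJ.ne']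
    congr 1
    push_cast
    field_simp
    ring
  refine ⟨by rw [hS]; positivity, ?_, fun v => ?_⟩
  · rw [hS, tsum_smul_abs_rpow (by positivity), huc', mul_one, ← Real.rpow_mul hJ.le]
    congr 1
    field_simp
  · rw [hS]
    rcases eq_or_ne (∑' n, |v n| ^ (2 * σ + 2)) 0 with h0 | h0
    · rw [h0]
      have := J_nonneg hω v
      positivity
    set P := ∑' n, |v n| ^ (2 * σ + 2) with hP
    have hP0 : 0 < P := lt_of_le_of_ne (tsum_nonneg fun n => by positivity) h0.symm
    set c := P ^ (-(1 / (2 * σ + 2))) with hc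
    have hc0 : 0 < c := by positivity
    have hmem : c • v ∈ constraintSet d σ := by
      change ∑' n, |(c • v) n| ^ (2 * σ + 2) = 1
      rw [tsum_smul_abs_rpow hc0.le, ← hP, hc, ← Real.rpow_mul hP0.le,
        ← Real.rpow_add_one hP0.ne']
      have : -(1 / (2 * σ + 2)) * (2 * σ + 2) + 1 = 0 := by field_simp; ring
      rw [this, Real.rpow_zero]
    have hle : j ≤ c ^ 2 * J ω v := by
      rw [← J_smul]; exact humin _ hmem
    have hpow : j ^ (σ + 1) ≤ (c ^ 2 * J ω v) ^ (σ + 1) := by gcongr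
    have hJv := J_nonneg hω v
    have hcp : (c ^ 2) ^ (σ + 1) = P⁻¹ := by
      rw [← Real.rpow_natCast, ← Real.rpow_mul hc0.le, hc, ← Real.rpow_mul hP0.le,
        ← Real.rpow_neg_one]
      congr 1
      push_cast
      field_simp
    rw [Real.mul_rpow (by positivity) hJv, hcp, inv_mul_eq_div, le_div_iff₀ hP0] at hpow
    rw [Real.div_rpow hJv (by positivity), ← Real.rpow_mul hJ.le]
    have e : (σ + 1) / σ * (σ + 1) = (σ + 1) / σ + (σ + 1) := by field_simp; ring
    have hT : j ^ ((σ + 1) / σ) ≠ 0 := by positivity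
    rw [e, Real.rpow_add hJ, ← mul_div_assoc, mul_div_mul_left _ _ hT,
      le_div_iff₀ (by positivity), mul_comm]
    exact hpow

variable {φ : EllTwo d ℝ}

theorem IsOptimizer.ne_zero (h : IsOptimizer σ ω φ) : φ ≠ 0 := by
  rintro rfl
  have := h.energy_pos
  rw [J_eq, map_zero, inner_zero_left] at this
  exact this.false

/-- The Euler–Lagrange equation. -/
theorem IsOptimizer.schrodinger_eq_potential (hσ : 0 < σ) (h : IsOptimizer σ ω φ) :
    schrodinger d ω φ = potential σ hσ φ φ := by
  refine ext_inner_right ℝ fun z => ?_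
  set S := J ω φ with hS
  have hS0 : 0 < S := h.energy_pos
  set b := ⟪schrodinger d ω φ, z⟫_ℝ with hb
  set b' := ⟪potential σ hσ φ φ, z⟫_ℝ with hb'
  set C := (σ + 1) * ((2 * σ + 1) * ⟪potential σ hσ φ z, z⟫_ℝ - 1 * ‖z‖ ^ 2) with hC
  -- Upper bound for the power sum of φ + tz minus its lower Taylor bound: f has a minimum at 0,
  -- with f'(0) = 2(σ+1)(b - b'). The quadratic terms, and so the choice ε = 1, do not matter.
  set f : ℝ → ℝ := fun t => S * ((S + t * (2 * b) + t ^ 2 * J ω z) / S) ^ (σ + 1) -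
    (S + t * ((2 * σ + 2) * b') + t ^ 2 * C) with hf
  have hf0 : f 0 = 0 := by simp [hf, div_self hS0.ne']
  have hmin : IsLocalMin f 0 := by
    filter_upwards [eventually_tsum_abs_rpow_ge hσ φ z one_pos] with t ht
    rw [h.power_eq] at ht
    have h2 := h.power_le (φ + t • z)
    rw [J_add_smul] at h2
    rw [hf0]
    exact sub_nonneg.2 (ht.trans h2)
  have hd : HasDerivAt f ((σ + 1) * (2 * b) - (2 * σ + 2) * b') 0 := by
    have e1 : ∀ p q r : ℝ, HasDerivAt (fun t : ℝ => p + t * q + t ^ 2 * r) q 0 := by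
      intro p q r
      have := (((hasDerivAt_id (0 : ℝ)).mul_const q).const_add p).add
        (((hasDerivAt_id (0 : ℝ)).pow 2).mul_const r)
      convert! this using 1
      simp
    have e2 := (((e1 S (2 * b) (J ω z)).div_const S).rpow_const (p := σ + 1)
      (Or.inr (by linarith))).const_mul S
    convert! e2.sub (e1 S ((2 * σ + 2) * b') C) using 1
    simp [div_self hS0.ne']
    field_simp
  have := hmin.hasDerivAt_eq_zero hd
  have h3 : (2 * (σ + 1)) * (b - b') = 0 := by linarith
  have h4 := (mul_eq_zero.1 h3).resolve_left (by positivity)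
  linarith

/-- The second-order condition: `L₊` is nonnegative on the tangent space of the constraint. -/
theorem IsOptimizer.inner_nonneg_of_tangent (hσ : 0 < σ) (h : IsOptimizer σ ω φ)
    {z : EllTwo d ℝ} (hz : ⟪potential σ hσ φ φ, z⟫_ℝ = 0) :
    (2 * σ + 1) * ⟪potential σ hσ φ z, z⟫_ℝ ≤ J ω z := by
  set S := J ω φ with hS
  have hS0 : 0 < S := h.energy_pos
  refine le_of_forall_pos_le_add fun η hη => ?_
  set ε := η / (‖z‖ ^ 2 + 1) with hε
  have hε0 : 0 < ε := by positivity
  set C := (2 * σ + 1) * ⟪potential σ hσ φ z, z⟫_ℝ - ε * ‖z‖ ^ 2 with hC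
  -- For tangent z the linear terms in t vanish, so s = t² turns the second-order condition into a
  -- one-sided first-order one.
  set f : ℝ → ℝ := fun s => S * ((S + s * J ω z) / S) ^ (σ + 1) - (S + s * ((σ + 1) * C)) with hf
  have hf0 : f 0 = 0 := by simp [hf, div_self hS0.ne']
  have hev : ∀ᶠ s in nhdsWithin 0 (Set.Ioi 0), 0 ≤ f s := by
    have ht : Filter.Tendsto Real.sqrt (nhdsWithin 0 (Set.Ioi 0)) (nhds 0) := by
      have := Real.continuous_sqrt.tendsto 0
      rw [Real.sqrt_zero] at this
      exact this.mono_left nhdsWithin_le_nhds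
    filter_upwards [ht.eventually (eventually_tsum_abs_rpow_ge hσ φ z hε0),
      self_mem_nhdsWithin] with s hs hs0
    have hs0' : (0 : ℝ) < s := hs0
    have h2 := h.power_le (φ + √s • z)
    rw [h.power_eq, hz, Real.sq_sqrt hs0'.le, mul_zero, mul_zero, add_zero] at hs
    rw [J_add_smul, h.schrodinger_eq_potential hσ, hz, Real.sq_sqrt hs0'.le, mul_zero, mul_zero,
      add_zero] at h2
    exact sub_nonneg.2 (hs.trans h2)
  have hd : HasDerivAt f ((σ + 1) * J ω z - (σ + 1) * C) 0 := by
    have e1 : ∀ p q : ℝ, HasDerivAt (fun t : ℝ => p + t * q) q 0 := by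
      intro p q
      have := ((hasDerivAt_id (0 : ℝ)).mul_const q).const_add p
      rwa [one_mul] at this
    have e2 := (((e1 S (J ω z)).div_const S).rpow_const (p := σ + 1)
      (Or.inr (by linarith))).const_mul S
    convert! e2.sub (e1 S ((σ + 1) * C)) using 1
    simp [div_self hS0.ne']
    field_simp
  have h1 := deriv_nonneg_of_eventually hd hf0 hev
  have h2 : 0 ≤ (σ + 1) * (J ω z - C) := by linarith
  have h3 := nonneg_of_mul_nonneg_right h2 (by linarith)
  have h4 : ε * ‖z‖ ^ 2 ≤ η := by
    rw [hε, div_mul_eq_mul_div, div_le_iff₀ (by positivity)]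
    nlinarith
  linarith

/-- `L₋` is nonnegative. -/
theorem IsOptimizer.inner_potential_le (hσ : 0 < σ) (hω : 0 < ω) (h : IsOptimizer σ ω φ)
    (w : EllTwo d ℝ) : ⟪potential σ hσ φ w, w⟫_ℝ ≤ J ω w := by
  set S := J ω φ with hS
  have hS0 : 0 < S := h.energy_pos
  -- At energy S both power sums in Young's inequality are at most S, and its weights add up to 1;
  -- the general case follows by scaling.
  have key : ∀ w : EllTwo d ℝ, J ω w = S → ⟪potential σ hσ φ w, w⟫_ℝ ≤ S := by
    intro w hw
    have hsum := ((summable_abs_rpow hσ φ).hasSum.mul_left (σ / (σ + 1))).add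
      ((summable_abs_rpow hσ w).hasSum.mul_left (1 / (σ + 1)))
    have h1 := hasSum_le (fun n => ?_) (summable_potential hσ φ w w).hasSum hsum
    · rw [← inner_potential hσ, h.power_eq] at h1
      have h2 := h.power_le w
      rw [← hS, hw, div_self hS0.ne', Real.one_rpow, mul_one] at h2
      calc _ ≤ _ := h1
        _ ≤ σ / (σ + 1) * S + 1 / (σ + 1) * S := by gcongr
        _ = S := by field_simp
    · rw [← pow_two]
      exact abs_rpow_mul_sq_le hσ (φ n) (w n)
  rcases eq_or_ne w 0 with rfl | hw
  · rw [J_eq, map_zero, map_zero]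
  have hJw := J_pos hω hw
  have h1 := key (√(S / J ω w) • w) (by
    rw [J_smul, Real.sq_sqrt (by positivity), div_mul_cancel₀ _ hJw.ne'])
  rw [map_smul, inner_smul_left, inner_smul_right, RCLike.conj_to_real, ← mul_assoc,
    Real.mul_self_sqrt (by positivity), div_mul_eq_mul_div, div_le_iff₀ hJw] at h1
  exact le_of_mul_le_mul_left h1 hS0

/-- The kernel of `L₋` is spanned by `φ`. -/
theorem IsOptimizer.exists_smul_of_mem_ker (hσ : 0 < σ) (hω : 0 < ω) (h : IsOptimizer σ ω φ)
    {w : EllTwo d ℝ} (hw : schrodinger d ω w - potential σ hσ φ w = 0) :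
    ∃ r : ℝ, w = r • φ := by
  have hsymm : ∀ x y, ⟪(schrodinger d ω - potential σ hσ φ) x, y⟫_ℝ =
      ⟪x, (schrodinger d ω - potential σ hσ φ) y⟫_ℝ := fun x y => by
    simp only [sub_apply, inner_sub_left, inner_sub_right, schrodinger_symm, potential_symm]
  have hpos : ∀ x, 0 ≤ ⟪(schrodinger d ω - potential σ hσ φ) x, x⟫_ℝ := fun x => by
    rw [sub_apply, inner_sub_left, ← J_eq]
    exact sub_nonneg.2 (h.inner_potential_le hσ hω x)
  -- Discrete strong maximum principle: |w| is also in the kernel, and at a zero of w its equation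
  -- says that the neighbouring values of |w| sum to 0. Zeros thus spread over the lattice.
  have key : ∀ w : EllTwo d ℝ, schrodinger d ω w - potential σ hσ φ w = 0 →
      ∀ n₀, w n₀ = 0 → w = 0 := by
    intro w hw n₀ hn₀
    have h0 : ⟪(schrodinger d ω - potential σ hσ φ) (absSeq w), absSeq w⟫_ℝ = 0 := by
      refine le_antisymm ?_ (hpos _)
      have e1 : ⟪potential σ hσ φ (absSeq w), absSeq w⟫_ℝ = ⟪potential σ hσ φ w, w⟫_ℝ := by
        rw [inner_potential, inner_potential]
        exact tsum_congr fun n => by simp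
      have e2 : ⟪schrodinger d ω w, w⟫_ℝ - ⟪potential σ hσ φ w, w⟫_ℝ = 0 := by
        rw [← inner_sub_left, hw, inner_zero_left]
      rw [sub_apply, inner_sub_left, e1]
      have := inner_schrodinger_absSeq_le ω w
      linarith
    have h1 := eq_zero_of_inner_self_eq_zero _ hsymm hpos h0
    have hn : ∀ n, w n = 0 → ∀ i, w (n + e i) = 0 ∧ w (n - e i) = 0 := by
      intro n hn i
      have h2 : schrodinger d ω (absSeq w) n - potential σ hσ φ (absSeq w) n = 0 := by
        have := congrArg (fun f : EllTwo d ℝ => f n) h1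
        simpa using this
      rw [schrodinger_apply, potential_apply, discLaplacian] at h2
      simp only [absSeq_apply, hn, abs_zero, smul_zero, mul_zero, sub_zero, add_zero,
        neg_eq_zero] at h2
      have h3 := (Finset.sum_eq_zero_iff_of_nonneg fun i _ => by positivity).1 h2 i
        (Finset.mem_univ i)
      have h4 := abs_nonneg (w (n + e i))
      have h5 := abs_nonneg (w (n - e i))
      exact ⟨abs_eq_zero.1 (by linarith), abs_eq_zero.1 (by linarith)⟩
    exact lp.ext (funext fun n => forall_of_neighbors (p := fun n => w n = 0) hn₀ hn n)
  obtain ⟨n₁, hn₁⟩ : ∃ n, φ n ≠ 0 := by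
    by_contra! hall
    exact h.ne_zero (lp.ext (funext hall))
  refine ⟨w n₁ / φ n₁, sub_eq_zero.1 (key _ ?_ n₁ ?_)⟩
  · rw [map_sub, map_sub, map_smul, map_smul, h.schrodinger_eq_potential hσ,
      ← sub_eq_zero.1 hw]
    abel
  · rw [lp.coeFn_sub, lp.coeFn_smul, Pi.sub_apply, Pi.smul_apply, smul_eq_mul,
      div_mul_cancel₀ _ hn₁, sub_self]

end Variational

/-! ### Real and imaginary parts of the linearized operators -/

section Complexification

variable {d : ℕ} {σ ω : ℝ}

/-- The real part of a complex sequence. -/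
noncomputable def rePart (u : EllTwo d ℂ) : EllTwo d ℝ :=
  ⟨fun n => (u n).re, (lp.memℓp u).mono' fun n => Complex.abs_re_le_norm (u n)⟩

/-- The imaginary part of a complex sequence. -/
noncomputable def imPart (u : EllTwo d ℂ) : EllTwo d ℝ :=
  ⟨fun n => (u n).im, (lp.memℓp u).mono' fun n => Complex.abs_im_le_norm (u n)⟩

/-- A real sequence regarded as a complex one. -/
noncomputable def toComplex (u : EllTwo d ℝ) : EllTwo d ℂ :=
  ⟨fun n => (u n : ℂ), (lp.memℓp u).mono' fun n => (Complex.norm_real (u n)).le⟩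

@[simp] theorem rePart_apply (u : EllTwo d ℂ) (n : Fin d → ℤ) : rePart u n = (u n).re := rfl

@[simp] theorem imPart_apply (u : EllTwo d ℂ) (n : Fin d → ℤ) : imPart u n = (u n).im := rfl

@[simp] theorem toComplex_apply (u : EllTwo d ℝ) (n : Fin d → ℤ) : toComplex u n = (u n : ℂ) := rfl

theorem eq_zero_of_parts {u : EllTwo d ℂ} (h₁ : rePart u = 0) (h₂ : imPart u = 0) : u = 0 := by
  refine lp.ext (funext fun n => Complex.ext ?_ ?_)
  · exact congrArg (fun f : EllTwo d ℝ => f n) h₁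
  · exact congrArg (fun f : EllTwo d ℝ => f n) h₂

/-- The operator `-Δ + ω - c |φ|^(2σ)`. -/
noncomputable def linearized (σ ω : ℝ) (hσ : 0 < σ) (c : ℝ) (φ : EllTwo d ℝ) :
    EllTwo d ℝ →L[ℝ] EllTwo d ℝ :=
  schrodinger d ω - c • potential σ hσ φ

theorem linearized_eq (hσ : 0 < σ) (c : ℝ) (φ u : EllTwo d ℝ) :
    linearized σ ω hσ c φ u = schrodinger d ω u - (c • potential σ hσ φ) u := rfl

theorem linearized_apply (hσ : 0 < σ) (c : ℝ) (φ u : EllTwo d ℝ) (n : Fin d → ℤ) :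
    linearized σ ω hσ c φ u n = -discLaplacian (⇑u) n + ω • u n - (c * |φ n| ^ (2 * σ)) • u n := by
  rw [linearized_eq, lp.coeFn_sub, Pi.sub_apply, schrodinger_apply, smul_apply, lp.coeFn_smul,
    Pi.smul_apply, potential_apply, smul_eq_mul, smul_eq_mul, smul_eq_mul, mul_assoc]

theorem linearized_symm (hσ : 0 < σ) (c : ℝ) (φ u v : EllTwo d ℝ) :
    ⟪linearized σ ω hσ c φ u, v⟫_ℝ = ⟪u, linearized σ ω hσ c φ v⟫_ℝ := by
  simp only [linearized_eq, smul_apply, inner_sub_left, inner_sub_right, inner_smul_left,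
    inner_smul_right, schrodinger_symm, potential_symm, RCLike.conj_to_real]

theorem Lplus_eq (hσ : 0 < σ) (φ u : EllTwo d ℝ) (n : Fin d → ℤ) :
    Lplus σ ω φ (⇑u) n = linearized σ ω hσ (2 * σ + 1) φ u n :=
  (linearized_apply hσ _ φ u n).symm

theorem Lminus_eq (hσ : 0 < σ) (φ u : EllTwo d ℝ) (n : Fin d → ℤ) :
    Lminus σ ω φ (⇑u) n = linearized σ ω hσ 1 φ u n := by
  rw [linearized_apply, one_mul, Lminus]

theorem re_discLaplacian (f : EllTwo d ℂ) (n : Fin d → ℤ) :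
    (discLaplacian (⇑f) n).re = discLaplacian (⇑(rePart f)) n := by
  simp [discLaplacian]

theorem im_discLaplacian (f : EllTwo d ℂ) (n : Fin d → ℤ) :
    (discLaplacian (⇑f) n).im = discLaplacian (⇑(imPart f)) n := by
  simp [discLaplacian]

theorem discLaplacian_toComplex (f : EllTwo d ℝ) (n : Fin d → ℤ) :
    discLaplacian (⇑(toComplex f)) n = ((discLaplacian (⇑f) n : ℝ) : ℂ) := by
  simp [discLaplacian]

theorem re_Lplus (φ : EllTwo d ℝ) (f : EllTwo d ℂ) (n : Fin d → ℤ) :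
    (Lplus σ ω φ (⇑f) n).re = Lplus σ ω φ (⇑(rePart f)) n := by
  simp only [Lplus, Complex.sub_re, Complex.add_re, Complex.neg_re, re_discLaplacian,
    Complex.smul_re, rePart_apply]

theorem im_Lplus (φ : EllTwo d ℝ) (f : EllTwo d ℂ) (n : Fin d → ℤ) :
    (Lplus σ ω φ (⇑f) n).im = Lplus σ ω φ (⇑(imPart f)) n := by
  simp only [Lplus, Complex.sub_im, Complex.add_im, Complex.neg_im, im_discLaplacian,
    Complex.smul_im, imPart_apply]

theorem re_Lminus (φ : EllTwo d ℝ) (f : EllTwo d ℂ) (n : Fin d → ℤ) :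
    (Lminus σ ω φ (⇑f) n).re = Lminus σ ω φ (⇑(rePart f)) n := by
  simp only [Lminus, Complex.sub_re, Complex.add_re, Complex.neg_re, re_discLaplacian,
    Complex.smul_re, rePart_apply]

theorem im_Lminus (φ : EllTwo d ℝ) (f : EllTwo d ℂ) (n : Fin d → ℤ) :
    (Lminus σ ω φ (⇑f) n).im = Lminus σ ω φ (⇑(imPart f)) n := by
  simp only [Lminus, Complex.sub_im, Complex.add_im, Complex.neg_im, im_discLaplacian,
    Complex.smul_im, imPart_apply]

theorem Lplus_toComplex (φ f : EllTwo d ℝ) (n : Fin d → ℤ) :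
    Lplus σ ω φ (⇑(toComplex f)) n = ((Lplus σ ω φ (⇑f) n : ℝ) : ℂ) := by
  simp only [Lplus, discLaplacian_toComplex, toComplex_apply, Complex.real_smul, smul_eq_mul]
  push_cast
  rfl

theorem Lminus_toComplex (φ f : EllTwo d ℝ) (n : Fin d → ℤ) :
    Lminus σ ω φ (⇑(toComplex f)) n = ((Lminus σ ω φ (⇑f) n : ℝ) : ℂ) := by
  simp only [Lminus, discLaplacian_toComplex, toComplex_apply, Complex.real_smul, smul_eq_mul]
  push_cast
  rfl

end Complexification

/-! ### Spectral stability and the sign of ⟪φ, L₊⁻¹φ⟫ -/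

section Stability

variable {d : ℕ} {σ ω : ℝ} {φ : EllTwo d ℝ}

theorem exists_equiv_linearized (hσ : 0 < σ) (hω : 0 < ω) (hnd : IsNondegenerate σ ω φ) :
    ∃ e : EllTwo d ℝ ≃L[ℝ] EllTwo d ℝ, ∀ x, e x = linearized σ ω hσ (2 * σ + 1) φ x := by
  refine exists_equiv_of_coercive_sub_compact (schrodinger d ω)
    ((2 * σ + 1) • potential σ hσ φ) hω (fun x => schrodinger_coercive x)
    ((isCompactOperator_potential hσ φ).smul (2 * σ + 1)) fun x hx => hnd x fun n => ?_
  rw [Lplus_eq hσ, linearized_eq, hx]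
  rfl

theorem IsOptimizer.linearized_one_self (hσ : 0 < σ) (h : IsOptimizer σ ω φ) :
    linearized σ ω hσ 1 φ φ = 0 := by
  rw [linearized_eq, one_smul, h.schrodinger_eq_potential hσ, sub_self]

/-- This makes φ a negative direction of L₊ and identifies the complement of L₊φ with the tangent
space of the constraint. -/
theorem IsOptimizer.linearized_self (hσ : 0 < σ) (h : IsOptimizer σ ω φ) :
    linearized σ ω hσ (2 * σ + 1) φ φ = -(2 * σ) • potential σ hσ φ φ := by
  rw [linearized_eq, h.schrodinger_eq_potential hσ, smul_apply]
  module

theorem inner_linearized (hσ : 0 < σ) (c : ℝ) (φ u : EllTwo d ℝ) :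
    ⟪linearized σ ω hσ c φ u, u⟫_ℝ = J ω u - c * ⟪potential σ hσ φ u, u⟫_ℝ := by
  rw [linearized_eq, inner_sub_left, ← J_eq, smul_apply, inner_smul_left]
  rfl

/-- The Vakhitov–Kolokolov criterion in terms of `ψ = L₊⁻¹ φ`. -/
theorem IsOptimizer.isSpectrallyStable_iff (hσ : 0 < σ) (hω : 0 < ω) (h : IsOptimizer σ ω φ)
    {ψ : EllTwo d ℝ} (hψ : linearized σ ω hσ (2 * σ + 1) φ ψ = φ) :
    IsSpectrallyStable σ ω φ ↔ ⟪φ, ψ⟫_ℝ ≤ 0 := by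
  have hpos : ∀ x, 0 ≤ ⟪linearized σ ω hσ 1 φ x, x⟫_ℝ := fun x => by
    rw [inner_linearized, one_mul]
    exact sub_nonneg.2 (h.inner_potential_le hσ hω x)
  have hφ := h.ne_zero
  constructor
  · intro hst
    by_contra! hlt
    have hneg : ⟪linearized σ ω hσ (2 * σ + 1) φ φ, φ⟫_ℝ < 0 := by
      rw [h.linearized_self hσ, inner_smul_left, inner_potential_self, h.power_eq]
      have := h.energy_pos
      simp only [RCLike.conj_to_real]
      nlinarith [mul_pos hσ this]
    obtain ⟨μ, hμ, v, w, hv, h₁, h₂⟩ := exists_growing_mode (schrodinger d ω)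
      ((2 * σ + 1) • potential σ hσ φ) ((1 : ℝ) • potential σ hσ φ) hω
      (fun x => schrodinger_coercive x) ((isCompactOperator_potential hσ φ).smul (2 * σ + 1))
      ((isCompactOperator_potential hσ φ).smul (1 : ℝ)) (linearized_symm hσ _ φ)
      (linearized_symm hσ _ φ) hpos hφ (h.linearized_one_self hσ)
      (fun x hx => h.exists_smul_of_mem_ker hσ hω (by simpa using hx)) hψ hneg hlt
    refine hst ⟨μ, toComplex v, toComplex w, by simpa using hμ, ?_, fun n => ?_, fun n => ?_⟩
    · intro h0
      refine hv (lp.ext (funext fun n => ?_))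
      have := congrArg (fun f : EllTwo d ℂ => f n) (Prod.mk.inj h0).1
      exact Complex.ofReal_eq_zero.1 this
    · rw [Lminus_toComplex, Lminus_eq hσ, toComplex_apply, ← Complex.ofReal_mul,
        ← Complex.ofReal_neg]
      exact congrArg Complex.ofReal (congrArg (fun f : EllTwo d ℝ => f n) h₁)
    · rw [Lplus_toComplex, Lplus_eq hσ, toComplex_apply, ← Complex.ofReal_mul]
      exact congrArg Complex.ofReal (congrArg (fun f : EllTwo d ℝ => f n) h₂)
  · rintro hle ⟨μ, v, w, hμ, hvw, h₁, h₂⟩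
    have hLpos : ∀ u, ⟪φ, u⟫_ℝ = 0 → 0 ≤ ⟪linearized σ ω hσ (2 * σ + 1) φ u, u⟫_ℝ := by
      intro u hu
      refine inner_nonneg_of_orthogonal _ (linearized_symm hσ _ φ) hφ hψ hle (fun z hz => ?_) hu
      rw [h.linearized_self hσ, inner_smul_left, mul_eq_zero] at hz
      have hz' := hz.resolve_left (by simpa using hσ.ne')
      rw [inner_linearized]
      exact sub_nonneg.2 (h.inner_nonneg_of_tangent hσ hz')
    obtain ⟨hv₁, hv₂, hw₁, hw₂⟩ := eq_zero_of_growing_mode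
      (linearized σ ω hσ (2 * σ + 1) φ) (linearized σ ω hσ 1 φ) (linearized_symm hσ _ φ)
      (linearized_symm hσ _ φ) hpos (h.linearized_one_self hσ) hLpos hμ
      (β := μ.im) (v₁ := rePart v) (v₂ := imPart v) (w₁ := rePart w) (w₂ := imPart w)
      (lp.ext (funext fun n => by
        have := congrArg Complex.re (h₁ n)
        rw [Complex.neg_re, re_Lminus, Lminus_eq hσ, Complex.mul_re] at this
        exact this))
      (lp.ext (funext fun n => by
        have := congrArg Complex.im (h₁ n)
        rw [Complex.neg_im, im_Lminus, Lminus_eq hσ, Complex.mul_im] at this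
        exact this))
      (lp.ext (funext fun n => by
        have := congrArg Complex.re (h₂ n)
        rw [re_Lplus, Lplus_eq hσ, Complex.mul_re] at this
        exact this))
      (lp.ext (funext fun n => by
        have := congrArg Complex.im (h₂ n)
        rw [im_Lplus, Lplus_eq hσ, Complex.mul_im] at this
        exact this))
    exact hvw (by rw [eq_zero_of_parts hv₁ hv₂, eq_zero_of_parts hw₁ hw₂]; rfl)

end Stability

/-! ### Differentiability of the branch -/

section Branch

variable {d : ℕ} {σ ω : ℝ}

open Asymptotics Filter Topology

/-- The map `u ↦ |u|^(2σ) u` is differentiable on `ℓ²`. -/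
theorem potential_self_sub_isLittleO (hσ : 0 < σ) (φ : EllTwo d ℝ) :
    (fun u => potential σ hσ u u - potential σ hσ φ φ - (2 * σ + 1) • potential σ hσ φ (u - φ))
      =o[𝓝 φ] fun u => u - φ := by
  rw [isLittleO_iff]
  intro ε hε
  obtain ⟨δ, hδ, H⟩ := exists_abs_rpow_mul_self_remainder (r := 2 * σ) (by positivity) ‖φ‖ hε
  filter_upwards [Metric.ball_mem_nhds φ hδ] with u hu
  rw [mem_ball_iff_norm] at hu
  refine norm_le_of_abs_le hε.le fun n => ?_
  have h := H (φ n) (u n) (abs_apply_le_norm φ n)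
    (lt_of_le_of_lt (abs_apply_le_norm (u - φ) n) hu)
  convert h using 2
  simp only [lp.coeFn_sub, lp.coeFn_smul, Pi.sub_apply, Pi.smul_apply, potential_apply, smul_eq_mul,
    mul_assoc]
  rfl

/-- A continuous branch of solutions with invertible linearization is differentiable. -/
theorem hasDerivAt_branch (hσ : 0 < σ) {φ : ℝ → EllTwo d ℝ} (hc : ContinuousAt φ ω)
    (heq : ∀ᶠ s in 𝓝 ω, schrodinger d s (φ s) = potential σ hσ (φ s) (φ s))
    (e : EllTwo d ℝ ≃L[ℝ] EllTwo d ℝ) (he : ∀ x, e x = linearized σ ω hσ (2 * σ + 1) (φ ω) x) :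
    HasDerivAt φ (-e.symm (φ ω)) ω := by
  set R : ℝ → EllTwo d ℝ := fun s => potential σ hσ (φ s) (φ s) - potential σ hσ (φ ω) (φ ω) -
    (2 * σ + 1) • potential σ hσ (φ ω) (φ s - φ ω) with hR
  have hRo : R =o[𝓝 ω] fun s => φ s - φ ω := (potential_self_sub_isLittleO hσ (φ ω)).comp_tendsto hc
  have hdiff : ∀ᶠ s in 𝓝 ω, e (φ s - φ ω) = R s - (s - ω) • φ s := by
    filter_upwards [heq] with s hs
    rw [he, linearized_eq, map_sub, smul_apply, hR]
    simp only
    rw [← hs, ← heq.self_of_nhds, schrodinger_add_freq ω s]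
    abel
  have hRe : R =o[𝓝 ω] fun s => e (φ s - φ ω) :=
    hRo.trans_isBigO (e.isBigO_comp_rev _ _)
  -- The remainder R is little-o of the left side and is absorbed by it. Mere continuity of the
  -- branch thus becomes a Lipschitz bound at ω, which makes R little-o of s - ω.
  have hO : (fun s => e (φ s - φ ω)) =O[𝓝 ω] fun s => s - ω := by
    refine hRe.right_isBigO_sub.trans ?_
    have h1 : (fun s => (s - ω) • φ s) =O[𝓝 ω] fun s => (s - ω) • (1 : ℝ) :=
      (isBigO_refl _ _).smul (hc.isBigO_one ℝ)
    simp only [smul_eq_mul, mul_one] at h1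
    refine h1.neg_left.congr' ?_ EventuallyEq.rfl
    filter_upwards [hdiff] with s hs
    rw [hs]
    abel
  have hO' : (fun s => φ s - φ ω) =O[𝓝 ω] fun s => s - ω := (e.isBigO_comp_rev _ _).trans hO
  have h2 : (fun s => (s - ω) • (φ s - φ ω)) =o[𝓝 ω] fun s => (s - ω) • (1 : ℝ) := by
    refine (isBigO_refl _ _).smul_isLittleO ?_
    rw [isLittleO_one_iff]
    simpa using hc.tendsto.sub_const (φ ω)
  simp only [smul_eq_mul, mul_one] at h2
  rw [hasDerivAt_iff_isLittleO]
  have h3 : (fun s => e (φ s - φ ω - (s - ω) • -e.symm (φ ω))) =o[𝓝 ω] fun s => s - ω := by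
    refine ((hRo.trans_isBigO hO').sub h2).congr' ?_ EventuallyEq.rfl
    filter_upwards [hdiff] with s hs
    rw [map_sub, hs, map_smul, map_neg, e.apply_symm_apply]
    module
  exact (e.isBigO_comp_rev _ _).trans_isLittleO h3

end Branch

end DNLS

/-! ### The slope criterion -/

theorem corollary2p5 (d : ℕ) (hd : 1 ≤ d) (σ : ℝ) (hσ : 0 < σ) (a b : ℝ) (ha : 0 ≤ a)
    (φ : ℝ → DNLS.EllTwo d ℝ)
    (hwave : ∀ ω ∈ Set.Ioo a b, DNLS.IsHomogeneousWave σ ω (φ ω))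
    (hcont : ContinuousOn φ (Set.Ioo a b))
    (hnondeg : ∀ ω ∈ Set.Ioo a b, DNLS.IsNondegenerate σ ω (φ ω)) :
    ∀ ω ∈ Set.Ioo a b,
      DifferentiableAt ℝ (fun s : ℝ => ‖φ s‖) ω ∧
      (DNLS.IsSpectrallyStable σ ω (φ ω) ↔ 0 ≤ deriv (fun s : ℝ => ‖φ s‖ ^ 2) ω) := by
  intro ω hω
  have hopt : ∀ s ∈ Set.Ioo a b, DNLS.IsOptimizer σ s (φ s) := fun s hs =>
    (hwave s hs).isOptimizer hσ (ha.trans_lt hs.1)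
  have hnhds : Set.Ioo a b ∈ nhds ω := Ioo_mem_nhds hω.1 hω.2
  have hω0 : 0 < ω := ha.trans_lt hω.1
  obtain ⟨e, he⟩ := DNLS.exists_equiv_linearized hσ hω0 (hnondeg ω hω)
  have hderiv := DNLS.hasDerivAt_branch hσ (hcont.continuousAt hnhds)
    (Filter.mem_of_superset hnhds fun s hs => (hopt s hs).schrodinger_eq_potential hσ) e he
  refine ⟨hderiv.differentiableAt.norm ℝ (hopt ω hω).ne_zero, ?_⟩
  -- The derivative of the branch is -ψ, so that of ‖φ‖² is -2⟪φ, ψ⟫.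
  rw [(hopt ω hω).isSpectrallyStable_iff hσ hω0 (ψ := e.symm (φ ω))
    (by rw [← he, e.apply_symm_apply]), hderiv.norm_sq.deriv, inner_neg_right]
  constructor <;> intro h <;> linarith
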